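/- Let $N=\{1,\dots,n\}$ with $n\ge 1$ be a set of agents and let $M=\{1,\dots,m\}$ be a set of $m\ge 0$ items arranged on a path $1-2-\cdots-m$. Each agent $i$ has a valuation function $v_i:2^M\to\mathbb{Z}$ with $v_i(\emptyset)=0$. Assume that the valuations are non-positive, that is, $v_i(S)\le 0$ for all $i\in N$ and $S\subseteq M$; no monotonicity or additivity is assumed. An allocation $\mathcal A=(A_1,\dots,A_n)$ is a partition of $M$ into $n$ possibly empty bundles, $A_i$ being given to agent $i$. A bundle is connected if it is empty or consists of consecutive items of the path. An allocation is $\mathrm{EQ1}^c_g$ (equitable up to one good and one chore) if for all $i,j\in N$ with $v_i(A_i)<v_j(A_j)$ there is a set $X\subseteq M$ with $|A_i\cap X|\le 1$, $|A_j\cap X|\le 1$ and $v_i(A_i\setminus X)\ge v_j(A_j\setminus X)$. It is $\mathrm{EQ1P}^c_g$ (the same over paths) if all bundles $A_i$ are connected and in each case $X$ can be chosen so that moreover $A_i\setminus X$ and $A_j\setminus X$ are connected. Then: 1. There always exists an $\mathrm{EQ1P}^c_g$ allocation; in particular, it is an $\mathrm{EQ1}^c_g$ allocation. 2. An $\mathrm{EQ1P}^c_g$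 allocation can be computed in polynomial time $O(n^2m^4)$, given a constant-time oracle for the valuations. Precisely, there are one program of a unit-cost random access machine (integer registers and arrays; addition, subtraction, comparison, indirect read and write) and a constant $C$, such that for all $n\ge1$, $m\ge 0$ and all non-positive valuations $v_1,\dots,v_n$, the program, started with $n$ and $m$ as input and with access to an oracle that, given $i,\ell,r$, returns $v_i(\{\ell,\ell+1,\dots,r\})$ in one step, halts after at most $C\,n^2\max(m,1)^4$ steps and outputs an $\mathrm{EQ1P}^c_g$ allocation, by listing for every item the agent who receives it. -/

import Mathlib

namespace PathFairDivision

/-! ### Fair division instances: agents `Fin n`, items `Fin m` lying on the path `0 - 1 - ... - (m-1)` -/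

/-- A profile of integral valuation functions: every agent values the empty bundle at `0`. -/
def IsValuation {n m : ℕ} (v : Fin n → Finset (Fin m) → ℤ) : Prop :=
  ∀ i, v i ∅ = 0

/-- Non-positive valuations: no agent has a positive value for any bundle. -/
def IsNonpositive {n m : ℕ} (v : Fin n → Finset (Fin m) → ℤ) : Prop :=
  ∀ i S, v i S ≤ 0

/-- An allocation is a partition of the items into `n` (possibly empty) bundles,
the `i`-th one going to agent `i`. -/
def IsAllocation {n m : ℕ} (A : Fin n → Finset (Fin m)) : Prop :=
  ∀ k : Fin m, ∃! i : Fin n, k ∈ A i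

/-- A bundle is connected if it induces a connected subgraph of the item path
(the empty bundle is connected, hence `Preconnected`). -/
def IsConnectedBundle {m : ℕ} (S : Finset (Fin m)) : Prop :=
  ((SimpleGraph.pathGraph m).induce (S : Set (Fin m))).Preconnected

/-- Equitability up to one good and one chore: whenever agent `i` is worse off than agent `j`,
this can be repaired by removing at most one item from each of their bundles. -/
def IsEQ1gc {n m : ℕ} (v : Fin n → Finset (Fin m) → ℤ) (A : Fin n → Finset (Fin m)) : Prop :=
  ∀ i j, v i (A i) < v j (A j) →
    ∃ X : Finset (Fin m), (A i ∩ X).card ≤ 1 ∧ (A j ∩ X).card ≤ 1 ∧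
      v j (A j \ X) ≤ v i (A i \ X)

/-- Equitability up to one good and one chore over paths: all bundles are connected,
and only item removals that leave the bundle connected are allowed. -/
def IsEQ1Pgc {n m : ℕ} (v : Fin n → Finset (Fin m) → ℤ) (A : Fin n → Finset (Fin m)) : Prop :=
  (∀ i, IsConnectedBundle (A i)) ∧
  ∀ i j, v i (A i) < v j (A j) →
    ∃ X : Finset (Fin m), (A i ∩ X).card ≤ 1 ∧ (A j ∩ X).card ≤ 1 ∧
      IsConnectedBundle (A i \ X) ∧ IsConnectedBundle (A j \ X) ∧
      v j (A j \ X) ≤ v i (A i \ X)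

/-! ### Unit-cost random access machines with a valuation oracle

Structured programs over integer registers and integer arrays. The only arithmetic is addition and
subtraction; each instruction, each comparison and each oracle call costs one step. -/

/-- Programs. Registers and arrays are named by natural numbers that are fixed in the program text,
so a program uses finitely many of them. -/
inductive Prog : Type
  /-- do nothing -/
  | skip : Prog
  /-- `const x c`: `x := c` -/
  | const (x : ℕ) (c : ℤ) : Prog
  /-- `add x y z`: `x := y + z` -/
  | add (x y z : ℕ) : Prog
  /-- `sub x y z`: `x := y - z` -/
  | sub (x y z : ℕ) : Prog
  /-- `load x a y`: `x := a[y]` -/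
  | load (x a y : ℕ) : Prog
  /-- `store a y x`: `a[y] := x` -/
  | store (a y x : ℕ) : Prog
  /-- `query x i l r`: `x :=` the value for agent `i` of the bundle of all items from `l` to `r` -/
  | query (x i l r : ℕ) : Prog
  /-- first `p`, then `q` -/
  | seq (p q : Prog) : Prog
  /-- `ifLt x y p q`: if `x < y` then `p` else `q` -/
  | ifLt (x y : ℕ) (p q : Prog) : Prog
  /-- `whileLt x y p`: while `x < y` do `p` -/
  | whileLt (x y : ℕ) (p : Prog) : Prog

/-- Contents of the registers and of the arrays (random access memory). -/
structure State : Type where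
  reg : ℕ → ℤ
  arr : ℕ → ℤ → ℤ

/-- Write `c` into register `x`. -/
def State.setReg (s : State) (x : ℕ) (c : ℤ) : State :=
  { s with reg := Function.update s.reg x c }

/-- Write `c` into cell `k` of array `a`. -/
def State.setArr (s : State) (a : ℕ) (k c : ℤ) : State :=
  { s with arr := Function.update s.arr a (Function.update (s.arr a) k c) }

/-- `Exec O p s t s'`: with oracle `O`, program `p` started in state `s` halts in state `s'` after
exactly `t` steps. -/
inductive Exec (O : ℤ → ℤ → ℤ → ℤ) : Prog → State → ℕ → State → Prop
  | skip (s : State) : Exec O .skip s 1 s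
  | const (s : State) (x : ℕ) (c : ℤ) : Exec O (.const x c) s 1 (s.setReg x c)
  | add (s : State) (x y z : ℕ) :
      Exec O (.add x y z) s 1 (s.setReg x (s.reg y + s.reg z))
  | sub (s : State) (x y z : ℕ) :
      Exec O (.sub x y z) s 1 (s.setReg x (s.reg y - s.reg z))
  | load (s : State) (x a y : ℕ) :
      Exec O (.load x a y) s 1 (s.setReg x (s.arr a (s.reg y)))
  | store (s : State) (a y x : ℕ) :
      Exec O (.store a y x) s 1 (s.setArr a (s.reg y) (s.reg x))
  | query (s : State) (x i l r : ℕ) :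
      Exec O (.query x i l r) s 1 (s.setReg x (O (s.reg i) (s.reg l) (s.reg r)))
  | seq {p q : Prog} {s s' s'' : State} {t t' : ℕ} :
      Exec O p s t s' → Exec O q s' t' s'' → Exec O (.seq p q) s (t + t') s''
  | ifTrue {x y : ℕ} {p q : Prog} {s s' : State} {t : ℕ} :
      s.reg x < s.reg y → Exec O p s t s' → Exec O (.ifLt x y p q) s (t + 1) s'
  | ifFalse {x y : ℕ} {p q : Prog} {s s' : State} {t : ℕ} :
      ¬ s.reg x < s.reg y → Exec O q s t s' → Exec O (.ifLt x y p q) s (t + 1) s'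
  | whileTrue {x y : ℕ} {p : Prog} {s s' s'' : State} {t t' : ℕ} :
      s.reg x < s.reg y → Exec O p s t s' → Exec O (.whileLt x y p) s' t' s'' →
        Exec O (.whileLt x y p) s (t + t' + 1) s''
  | whileFalse {x y : ℕ} {p : Prog} {s : State} :
      ¬ s.reg x < s.reg y → Exec O (.whileLt x y p) s 1 s

/-- The machine is deterministic: final state and number of steps are determined by the program,
the oracle and the initial state. -/
theorem Exec.deterministic {O : ℤ → ℤ → ℤ → ℤ} {p : Prog} {s s₁ s₂ : State} {t₁ t₂ : ℕ}
    (h₁ : Exec O p s t₁ s₁) (h₂ : Exec O p s t₂ s₂) : t₁ = t₂ ∧ s₁ = s₂ := by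
  induction h₁ generalizing t₂ s₂ with
  | seq _ _ ih ih' =>
    cases h₂ with
    | seq a b =>
      obtain ⟨rfl, rfl⟩ := ih a
      obtain ⟨rfl, rfl⟩ := ih' b
      exact ⟨rfl, rfl⟩
  | ifTrue h _ ih =>
    cases h₂ with
    | ifTrue _ a => obtain ⟨rfl, rfl⟩ := ih a; exact ⟨rfl, rfl⟩
    | ifFalse h' _ => exact absurd h h'
  | ifFalse h _ ih =>
    cases h₂ with
    | ifTrue h' _ => exact absurd h' h
    | ifFalse _ a => obtain ⟨rfl, rfl⟩ := ih a; exact ⟨rfl, rfl⟩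
  | whileTrue h _ _ ih ih' =>
    cases h₂ with
    | whileTrue _ a b =>
      obtain ⟨rfl, rfl⟩ := ih a
      obtain ⟨rfl, rfl⟩ := ih' b
      exact ⟨rfl, rfl⟩
    | whileFalse h' => exact absurd h h'
  | whileFalse h =>
    cases h₂ with
    | whileTrue h' _ _ => exact absurd h' h
    | whileFalse _ => exact ⟨rfl, rfl⟩
  | _ => cases h₂; exact ⟨rfl, rfl⟩

/-- The bundle of all items `k` with `l ≤ k ≤ r` (empty if there is none). -/
def interval (m : ℕ) (l r : ℤ) : Finset (Fin m) :=
  Finset.univ.filter fun k : Fin m => l ≤ (k : ℤ) ∧ (k : ℤ) ≤ r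

/-- The valuation oracle: it returns the value that agent `i` has for the items from `l` to `r`
(and `0` if `i` is not the number of an agent). -/
def oracle {n m : ℕ} (v : Fin n → Finset (Fin m) → ℤ) (i l r : ℤ) : ℤ :=
  if h : 0 ≤ i ∧ i.toNat < n then v ⟨i.toNat, h.2⟩ (interval m l r) else 0

/-- Initial state: the numbers of agents and of items are in registers `0` and `1`;
everything else is `0`. -/
def initState (n m : ℕ) : State where
  reg x := if x = 0 then (n : ℤ) else if x = 1 then (m : ℤ) else 0
  arr _ _ := 0

/-- The allocation `A` is written in state `s`: cell `k` of array `0` holds the number of the agent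
who receives item `k`. -/
def State.Outputs {n m : ℕ} (s : State) (A : Fin n → Finset (Fin m)) : Prop :=
  ∀ (i : Fin n) (k : Fin m), k ∈ A i ↔ s.arr 0 (k : ℤ) = (i : ℤ)

end PathFairDivision

/-!
All bundles are intervals, handed out in the fixed order `0, …, n - 1` of the agents from left to
right. Call a threshold `τ` *good* for the bundle of an agent if `τ` lies between the least and the
greatest of his values for the bundle itself, for the bundle without its first item, and for the
bundle without its last item (`Good`). If all bundles share a good threshold, the allocation is
equitable up to one good and one chore: of the worse-off agent's bundle an item is removed so that
its value is at least `τ`, of the other one so that its value is at most `τ`, and the two removals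
do not interfere because the bundles are disjoint (`IsCutSequence.isEQ1Pgc`).

A common good threshold exists by a discrete connectivity argument (`exists_reach`). A partial
solution for `k` agents is a pair `(x, τ)` such that the first `x` items can be divided among the
first `k` agents with common good threshold `τ ≤ 0`. By induction on `k ≥ 1` there is a lattice path
of partial solutions from threshold `0` to the cut `x = m`. For one more agent, consider the grid of
pairs of a point `(x, τ)` of the path and a next cut `y`, and colour such a pair according to
whether `x ≤ y` and the new agent values the items `x, …, y - 1` at most at `τ`. Every edge of the
grid whose ends have different colours gives a partial solution for `k + 1` agents, and the edges of
one unit square give partial solutions that are connected with each other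
(`good_of_right`, `exists_good_of_step`). Empty bundles have value `0`, all values are at most `0`,
and the threshold is negative after the start, so just one two-coloured edge lies on the sides of
the grid other than the side `y = m`. By parity (`exists_marked_edge_top`) the two-coloured edges
connected with it reach that side (`exists_linked_succ`). The induction starts from the empty cut
`x = 0` for no agents, with thresholds from `0` down to one below all values.

A good threshold can moreover be taken from the values of the agents for intervals
(`Reach.exists_eq_value`). The program tries these `n (m + 1)²` values. For each of them it decides
by dynamic programming over the number of agents and the number of items whether the threshold is
good for a division of all items; this takes `O(n m²)` steps, and `O(n m)` more to read off such a
division from the table (`runsIn_fillTable`, `runsIn_trace`, `runsIn_solve`).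
-/

namespace PathFairDivision

/-! ### Intervals that fit a threshold -/

/-- The threshold `τ` lies between the smallest and the largest of the values of the bundle
`{x, …, y - 1}`, of this bundle without its first item, and of this bundle without its last item;
`F x y` stands for the value of `{x, …, y - 1}`. -/
def Good (F : ℤ → ℤ → ℤ) (τ x y : ℤ) : Prop :=
  (F x y ≤ τ ∨ F (x + 1) y ≤ τ ∨ F x (y - 1) ≤ τ) ∧
    (τ ≤ F x y ∨ τ ≤ F (x + 1) y ∨ τ ≤ F x (y - 1))

/-- The first `y` items can be cut into intervals for the agents `0, …, k - 1`, in this order from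
left to right, in such a way that `τ` is a common threshold for their bundles. -/
def Reach (F : ℕ → ℤ → ℤ → ℤ) (τ : ℤ) : ℕ → ℤ → Prop
  | 0, y => y = 0
  | k + 1, y => ∃ x, x ≤ y ∧ Reach F τ k x ∧ Good (F k) τ x y

theorem Reach.nonneg {F : ℕ → ℤ → ℤ → ℤ} {τ : ℤ} : ∀ {k : ℕ} {y : ℤ}, Reach F τ k y → 0 ≤ y
  | 0, _, h => le_of_eq (Eq.symm h)
  | _ + 1, _, ⟨_, hx, h, _⟩ => h.nonneg.trans hx

/-! ### A parity lemma for two-coloured grids -/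

/-- Colour the points of a grid by `P`. Suppose that some of the two-coloured edges are marked
(`H s y` marks the edge from `(s, y)` to `(s + 1, y)`, and `W s y` the one from `(s, y)` to
`(s, y + 1)`) so that in each unit square all two-coloured edges are marked or none is. If the
bottom and the right side are monochromatic and just one two-coloured edge of the left side is
marked, then a marked two-coloured edge lies on the top side: every square has an even number of
marked two-coloured edges, hence so has the boundary. -/
theorem exists_marked_edge_top (L M : ℕ) (P H W : ℕ → ℕ → Prop)
    (hsq : ∀ s < L, ∀ y < M, ∃ c : Prop,
      (¬(P s y ↔ P (s + 1) y) → (H s y ↔ c)) ∧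
      (¬(P s (y + 1) ↔ P (s + 1) (y + 1)) → (H s (y + 1) ↔ c)) ∧
      (¬(P s y ↔ P s (y + 1)) → (W s y ↔ c)) ∧
      (¬(P (s + 1) y ↔ P (s + 1) (y + 1)) → (W (s + 1) y ↔ c)))
    (hbot : ∀ s < L, (P s 0 ↔ P (s + 1) 0))
    (hright : ∀ y < M, (P L y ↔ P L (y + 1)))
    (y₀ : ℕ) (hy₀ : y₀ < M) (hleft : ∀ y < M, (¬(P 0 y ↔ P 0 (y + 1)) ↔ y = y₀))
    (hW : W 0 y₀) :
    ∃ s < L, ¬(P s M ↔ P (s + 1) M) ∧ H s M := by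
  classical
  by_contra hex
  have hno : ∀ s < L, ¬(P s M ↔ P (s + 1) M) → ¬H s M :=
    fun s hs h1 h2 => hex ⟨s, hs, h1, h2⟩
  let h : ℕ → ℕ → ZMod 2 := fun s y => if ¬(P s y ↔ P (s + 1) y) ∧ H s y then 1 else 0
  let w : ℕ → ℕ → ZMod 2 := fun s y => if ¬(P s y ↔ P s (y + 1)) ∧ W s y then 1 else 0
  have two : ∀ a : ZMod 2, a + a = 0 := by decide
  have square : ∀ s < L, ∀ y < M, w s y + w (s + 1) y = h s y + h s (y + 1) := by
    intro s hs y hy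
    obtain ⟨c, h1, h2, h3, h4⟩ := hsq s hs y hy
    simp only [h, w]
    by_cases hc : c <;> by_cases a1 : P s y <;> by_cases a2 : P (s + 1) y <;>
      by_cases a3 : P s (y + 1) <;> by_cases a4 : P (s + 1) (y + 1) <;>
      simp_all
  have column : ∀ s < L, ∀ N ≤ M,
      ∑ y ∈ Finset.range N, w s y + ∑ y ∈ Finset.range N, w (s + 1) y = h s 0 + h s N := by
    intro s hs N hN
    induction N with
    | zero => simp [two]
    | succ N ih =>
      rw [Finset.sum_range_succ, Finset.sum_range_succ, add_add_add_comm, ih (by omega),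
        square s hs N (by omega), add_assoc, ← add_assoc (h s N), two, zero_add]
  have const : ∀ s ≤ L, ∑ y ∈ Finset.range M, w s y = ∑ y ∈ Finset.range M, w 0 y := by
    intro s hs
    induction s with
    | zero => rfl
    | succ s ih =>
      have h1 := column s (by omega) M le_rfl
      have h2 : h s 0 = 0 := by simp [h, hbot s (by omega)]
      have h3 : h s M = 0 := by
        simp only [h]
        rw [if_neg]
        rintro ⟨ha, hb⟩
        exact hno s (by omega) ha hb
      rw [h2, h3, zero_add, ih (by omega)] at h1
      calc _ = (∑ y ∈ Finset.range M, w 0 y + ∑ y ∈ Finset.range M, w 0 y)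
              + ∑ y ∈ Finset.range M, w (s + 1) y := by rw [two, zero_add]
        _ = _ := by rw [add_assoc, h1, add_zero]
  have hl : ∑ y ∈ Finset.range M, w L y = 0 := by
    refine Finset.sum_eq_zero fun y hy => ?_
    simp [w, hright y (Finset.mem_range.1 hy)]
  have h0 : ∑ y ∈ Finset.range M, w 0 y = 1 := by
    rw [Finset.sum_eq_single_of_mem y₀ (Finset.mem_range.2 hy₀)]
    · simp only [w]
      rw [if_pos ⟨(hleft y₀ hy₀).2 rfl, hW⟩]
    · intro y hy hne
      simp only [w]
      rw [if_neg]
      exact fun hh => hne ((hleft y (Finset.mem_range.1 hy)).1 hh.1)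
  rw [const L le_rfl, h0] at hl
  exact one_ne_zero hl

/-! ### Lattice paths of partial solutions -/

/-- The pair of a cut position `x` and a threshold `τ` is a partial solution for the first `k`
agents. -/
def IsPartial (F : ℕ → ℤ → ℤ → ℤ) (m : ℤ) (k : ℕ) (a : ℤ × ℤ) : Prop :=
  a.1 ≤ m ∧ a.2 ≤ 0 ∧ Reach F a.2 k a.1

/-- Two partial solutions that are equal or neighbours in the integer lattice. -/
def Linked (F : ℕ → ℤ → ℤ → ℤ) (m : ℤ) (k : ℕ) (a b : ℤ × ℤ) : Prop :=
  IsPartial F m k a ∧ IsPartial F m k b ∧ |a.1 - b.1| + |a.2 - b.2| ≤ 1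

theorem Linked.symm {F : ℕ → ℤ → ℤ → ℤ} {m : ℤ} {k : ℕ} {a b : ℤ × ℤ} (h : Linked F m k a b) :
    Linked F m k b a := by
  refine ⟨h.2.1, h.1, ?_⟩
  rw [abs_sub_comm b.1, abs_sub_comm b.2]
  exact h.2.2

theorem exists_seq_of_reflTransGen {α : Type*} {r : α → α → Prop} {a b : α}
    (h : Relation.ReflTransGen r a b) :
    ∃ (L : ℕ) (p : ℕ → α), p 0 = a ∧ p L = b ∧ ∀ s < L, r (p s) (p (s + 1)) := by
  induction h with
  | refl => exact ⟨0, fun _ => a, rfl, rfl, by simp⟩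
  | @tail b c _ hbc ih =>
    obtain ⟨L, p, h0, hL, hp⟩ := ih
    refine ⟨L + 1, fun s => if s ≤ L then p s else c, by simp [h0], by simp, ?_⟩
    intro s hs
    rcases Nat.lt_or_ge s L with h | h
    · have h' : s + 1 ≤ L := h
      simpa [h.le, h'] using hp s h
    · obtain rfl : s = L := by omega
      simpa [hL] using hbc

/-- A change of colour between the right ends `y` and `y + 1`, at the left end `x` and the threshold
`q`: the bundle `{x, …, y}` then fits `q`, and even `q + 1` unless this is positive. If `y + 1 = x`
the bundle is empty, and the change of colour forces `q = 0`. -/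
theorem good_of_right {F : ℤ → ℤ → ℤ} (hF : ∀ x y, y ≤ x → F x y = 0) {x y q τ : ℤ}
    (hb : ¬((x ≤ y ∧ F x y ≤ q) ↔ (x ≤ y + 1 ∧ F x (y + 1) ≤ q)))
    (h1 : q ≤ τ) (h2 : τ ≤ q + 1) (h3 : τ ≤ 0) : x ≤ y + 1 ∧ Good F τ x (y + 1) := by
  unfold Good
  rw [add_sub_cancel_right]
  rcases le_or_gt x y with h | h
  · refine ⟨by omega, ?_⟩
    have : x ≤ y + 1 := by omega
    simp only [h, this, true_and] at hb
    constructor <;> by_contra hc <;> omega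
  · rcases eq_or_lt_of_le (show y + 1 ≤ x by omega) with h' | h'
    · have := hF x (y + 1) h'.le
      refine ⟨by omega, ?_⟩
      rw [this] at hb ⊢
      have hx : ¬ x ≤ y := by omega
      have hx' : x ≤ y + 1 := by omega
      simp only [hx, hx', true_and, false_and, false_iff, not_not] at hb
      exact ⟨Or.inl (by omega), Or.inl h3⟩
    · exact absurd (by constructor <;> intro ⟨_, _⟩ <;> omega) hb

/-- A change of colour between the left ends `x` and `x + 1`, at the right end `y` and the threshold
`q`: the larger bundle `{x, …, y - 1}` then fits `q`. -/
theorem good_of_left {F : ℤ → ℤ → ℤ} (hF : ∀ x y, y ≤ x → F x y = 0) {x y q : ℤ} (hq : q < 0)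
    (hb : ¬((x ≤ y ∧ F x y ≤ q) ↔ (x + 1 ≤ y ∧ F (x + 1) y ≤ q))) :
    x ≤ y ∧ Good F q x y := by
  unfold Good
  rcases lt_or_ge x y with h | h
  · refine ⟨h.le, ?_⟩
    have h' : x + 1 ≤ y := by omega
    simp only [h.le, h', true_and] at hb
    constructor <;> by_contra hc <;> omega
  · have := hF x y h
    exact absurd (by constructor <;> intro ⟨_, _⟩ <;> omega) hb

/-- A path of partial solutions can be shortened so that its threshold is negative after the
start. -/
theorem exists_seq_neg {F : ℕ → ℤ → ℤ → ℤ} {m : ℤ} {k : ℕ} {a b : ℤ × ℤ} (ha : a.2 = 0)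
    (hpa : IsPartial F m k a) (h : Relation.ReflTransGen (Linked F m k) a b) :
    ∃ (L : ℕ) (p : ℕ → ℤ × ℤ), (p 0).2 = 0 ∧ p L = b ∧ IsPartial F m k (p 0) ∧
      (∀ s < L, Linked F m k (p s) (p (s + 1))) ∧ ∀ s < L, (p (s + 1)).2 < 0 := by
  classical
  obtain ⟨L, p, h0, hL, hp⟩ := exists_seq_of_reflTransGen h
  have hpar : ∀ s ≤ L, IsPartial F m k (p s) := by
    intro s hs
    rcases Nat.eq_zero_or_pos s with rfl | h'
    · rwa [h0]
    · have := (hp (s - 1) (by omega)).2.1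
      rwa [Nat.sub_add_cancel h'] at this
  -- The last visit to threshold `0` becomes the start.
  let s₀ := Nat.findGreatest (fun s => (p s).2 = 0) L
  have hs₀ : s₀ ≤ L := Nat.findGreatest_le L
  have hz : (p s₀).2 = 0 :=
    Nat.findGreatest_spec (P := fun s => (p s).2 = 0) (Nat.zero_le L) (by rw [h0, ha])
  refine ⟨L - s₀, fun s => p (s₀ + s), hz, ?_, hpar _ hs₀, ?_, ?_⟩
  · simpa [Nat.add_sub_cancel' hs₀] using hL
  · exact fun s hs => hp (s₀ + s) (by omega)
  · intro s hs
    refine lt_of_le_of_ne (hpar (s₀ + (s + 1)) (by omega)).2.1 ?_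
    exact Nat.findGreatest_is_greatest (P := fun s => (p s).2 = 0) (n := L)
      (k := s₀ + (s + 1)) (show s₀ < s₀ + (s + 1) by omega) (by omega)

/-- A change of colour along a step of the path, at the next cut `y`, yields a bundle that fits the
larger one of the two thresholds. -/
theorem exists_good_of_step {F : ℤ → ℤ → ℤ} (hF : ∀ x y, y ≤ x → F x y = 0) {x q x' q' y : ℤ}
    (hq' : q' < 0) (hd : |x - x'| + |q - q'| ≤ 1)
    (hb : ¬((x ≤ y ∧ F x y ≤ q) ↔ (x' ≤ y ∧ F x' y ≤ q'))) :
    ∃ z, (z = x ∧ max q q' = q ∨ z = x' ∧ max q q' = q') ∧ z ≤ y ∧ Good F (max q q') z y := by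
  have cases5 : (x' = x ∧ q' = q) ∨ (x' = x + 1 ∧ q' = q) ∨ (x = x' + 1 ∧ q' = q) ∨
      (x' = x ∧ q' = q + 1) ∨ (x' = x ∧ q = q' + 1) := by
    rcases abs_cases (x - x') with h | h <;> rcases abs_cases (q - q') with h' | h' <;> omega
  rcases cases5 with ⟨rfl, rfl⟩ | ⟨rfl, rfl⟩ | ⟨rfl, rfl⟩ | ⟨rfl, rfl⟩ | ⟨rfl, rfl⟩
  · exact absurd Iff.rfl hb
  · rw [max_self]
    exact ⟨x, Or.inl ⟨rfl, rfl⟩, good_of_left hF hq' hb⟩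
  · rw [max_self]
    exact ⟨x', Or.inr ⟨rfl, rfl⟩, good_of_left hF hq' fun h => hb h.symm⟩
  · rw [max_eq_right (by omega)]
    have h1 : x' ≤ y := by
      by_contra h
      simp [h] at hb
    simp only [h1, true_and] at hb
    exact ⟨x', Or.inr ⟨rfl, rfl⟩, h1, Or.inl (by omega), Or.inl (by omega)⟩
  · rw [max_eq_left (by omega)]
    have h1 : x' ≤ y := by
      by_contra h
      simp [h] at hb
    simp only [h1, true_and] at hb
    exact ⟨x', Or.inl ⟨rfl, rfl⟩, h1, Or.inl (by omega), Or.inl (by omega)⟩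

/-- One more agent: a path of partial solutions for `k` agents that starts at threshold `0` and
ends at the cut `m`, or at a threshold below all values of agent `k`, yields such a path for
`k + 1` agents, ending at the cut `m`. It is traced by the boundary between the pairs (point of the
path, next cut) for which agent `k` values the new bundle at most at the threshold and the other
pairs. -/
theorem exists_linked_succ {F : ℕ → ℤ → ℤ → ℤ} {m : ℕ} {k : ℕ}
    (hF : ∀ x y, y ≤ x → F k x y = 0) (hneg : ∀ x y, F k x y ≤ 0) {a b : ℤ × ℤ} (ha : a.2 = 0)
    (hpa : IsPartial F m k a) (h : Relation.ReflTransGen (Linked F m k) a b)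
    (hb : b.1 = m ∨ ∀ x y, b.2 < F k x y) :
    ∃ a' b' : ℤ × ℤ, a'.2 = 0 ∧ IsPartial F m (k + 1) a' ∧
      Relation.ReflTransGen (Linked F m (k + 1)) a' b' ∧ b'.1 = m := by
  obtain ⟨L, p, h0, hL, hp0, hp, hpneg⟩ := exists_seq_neg ha hpa h
  have hpar : ∀ s ≤ L, IsPartial F m k (p s) := by
    intro s hs
    rcases Nat.eq_zero_or_pos s with rfl | h'
    · exact hp0
    · have := (hp (s - 1) (by omega)).2.1
      rwa [Nat.sub_add_cancel h'] at this
  have hx0 : ∀ s ≤ L, 0 ≤ (p s).1 := fun s hs => (hpar s hs).2.2.nonneg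
  have hstart : IsPartial F m (k + 1) ((p 0).1, 0) := by
    refine ⟨hp0.1, le_rfl, (p 0).1, le_rfl, h0 ▸ hp0.2.2, ?_⟩
    have := hF (p 0).1 (p 0).1 le_rfl
    exact ⟨Or.inl this.le, Or.inl this.ge⟩
  rcases Nat.eq_zero_or_pos L with rfl | hLpos
  · rcases hb with hb | hb
    · exact ⟨_, _, rfl, hstart, .refl, by rw [hL]; exact hb⟩
    · have := hb 0 0
      rw [hF 0 0 le_rfl, ← hL, h0] at this
      exact absurd this (lt_irrefl _)
  let P : ℕ → ℕ → Prop := fun s y => (p s).1 ≤ (y : ℤ) - 1 ∧ F k (p s).1 ((y : ℤ) - 1) ≤ (p s).2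
  let Q : ℤ × ℤ → Prop := fun c => Relation.ReflTransGen (Linked F m (k + 1)) ((p 0).1, 0) c
  have hQ : ∀ c d, Linked F m (k + 1) c d → (Q c ↔ Q d) :=
    fun c d hcd => ⟨fun hc => hc.tail hcd, fun hd => hd.tail hcd.symm⟩
  -- The grid coordinate `y` stands for the cut `y - 1`, so that the bottom side is monochromatic. A
  -- two-coloured edge from `y` to `y + 1` gives a partial solution with the cut `y`, also for the
  -- next threshold above `(p s).2` if `(p s).1` is a cut for it.
  have hvert : ∀ s ≤ L, ∀ y < m + 1, ¬(P s y ↔ P s (y + 1)) → ∀ τ, (p s).2 ≤ τ → τ ≤ (p s).2 + 1 →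
      τ ≤ 0 → Reach F τ k (p s).1 → IsPartial F m (k + 1) (((y : ℕ) : ℤ), τ) := by
    intro s hs y hy hc τ h1 h2 h3 hr
    have hc' : ¬((p s).1 ≤ (y : ℤ) - 1 ∧ F k (p s).1 ((y : ℤ) - 1) ≤ (p s).2 ↔
        (p s).1 ≤ (y : ℤ) - 1 + 1 ∧ F k (p s).1 ((y : ℤ) - 1 + 1) ≤ (p s).2) := by
      have e : (((y + 1 : ℕ) : ℤ)) - 1 = (y : ℤ) - 1 + 1 := by push_cast; ring
      simpa only [P, e] using hc
    obtain ⟨h4, h5⟩ := good_of_right hF hc' h1 h2 h3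
    rw [sub_add_cancel] at h4 h5
    exact ⟨by simpa using Nat.lt_succ_iff.1 hy, h3, _, h4, hr, h5⟩
  -- A two-coloured edge along a step of the path gives one for the larger of the two thresholds.
  have hhor : ∀ s < L, ∀ y ≤ m + 1, ¬(P s y ↔ P (s + 1) y) →
      IsPartial F m (k + 1) ((y : ℤ) - 1, max (p s).2 (p (s + 1)).2) := by
    intro s hs y hy hc
    simp only [P] at hc
    obtain ⟨⟨_, hq1, hr1⟩, ⟨_, hq2, hr2⟩, hd⟩ := hp s hs
    have hn := hpneg s hs
    refine ⟨by simp; omega, max_le hq1 hq2, ?_⟩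
    obtain ⟨z, hz, h1, h2⟩ := exists_good_of_step hF hn hd hc
    refine ⟨z, h1, ?_, h2⟩
    rcases hz with ⟨rfl, h3⟩ | ⟨rfl, h3⟩
    · rw [h3]; exact hr1
    · rw [h3]; exact hr2
  -- The hub of the unit square at `(s, y)` is the cut `y` at the larger one of the thresholds of
  -- `s` and `s + 1`: all two-coloured edges of the square are compared with it.
  have hhub : ∀ s < L, ∀ y < m + 1, ∀ t, t = s ∨ t = s + 1 → ¬(P t y ↔ P t (y + 1)) →
      Linked F m (k + 1) ((y : ℤ), (p t).2) ((y : ℤ), max (p s).2 (p (s + 1)).2) := by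
    intro s hs y hy t ht hc
    obtain ⟨⟨_, hq1, hr1⟩, ⟨_, hq2, hr2⟩, hd⟩ := hp s hs
    have htL : t ≤ L := by omega
    refine ⟨hvert t htL y hy hc _ le_rfl (by omega) (hpar t htL).2.1 (hpar t htL).2.2, ?_, ?_⟩
    · refine hvert t htL y hy hc _ ?_ ?_ (max_le hq1 hq2) ?_
      · rcases ht with rfl | rfl
        · exact le_max_left _ _
        · exact le_max_right _ _
      · have := abs_nonneg ((p s).1 - (p (s + 1)).1)
        have := abs_le.1 (show |(p s).2 - (p (s + 1)).2| ≤ 1 by omega)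
        rcases ht with rfl | rfl <;> omega
      · rcases eq_or_ne (p s).2 (p (s + 1)).2 with he | he
        · rw [he, max_self]
          rcases ht with rfl | rfl
          · exact he ▸ hr1
          · exact hr2
        · have h1 : 1 ≤ |(p s).2 - (p (s + 1)).2| := Int.one_le_abs (sub_ne_zero.2 he)
          have h2 : (p s).1 = (p (s + 1)).1 := by
            have := abs_nonneg ((p s).1 - (p (s + 1)).1)
            exact sub_eq_zero.1 (abs_eq_zero.1 (by omega))
          have h3 : (p t).1 = (p s).1 ∧ (p t).1 = (p (s + 1)).1 := by
            rcases ht with rfl | rfl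
            · exact ⟨rfl, h2⟩
            · exact ⟨h2.symm, rfl⟩
          rcases max_choice (p s).2 (p (s + 1)).2 with h4 | h4
          · rw [h4, h3.1]; exact hr1
          · rw [h4, h3.2]; exact hr2
    · have h1 := abs_nonneg ((p s).1 - (p (s + 1)).1)
      have h2 := abs_le.1 (show |(p s).2 - (p (s + 1)).2| ≤ 1 by omega)
      simp only [sub_self, abs_zero, zero_add]
      rw [abs_le]
      rcases ht with rfl | rfl <;> omega
  have hend : ∀ y ≤ m + 1, ¬P L y := by
    intro y hy hP
    simp only [P] at hP
    have hn : (p L).2 < 0 := by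
      have := hpneg (L - 1) (by omega)
      rwa [Nat.sub_add_cancel hLpos] at this
    rw [hL] at hP hn
    rcases hb with hb | hb
    · have := hF b.1 ((y : ℤ) - 1) (by omega)
      omega
    · have := hb b.1 ((y : ℤ) - 1)
      omega
  have hP0 : ∀ y : ℕ, P 0 y ↔ (p 0).1 ≤ (y : ℤ) - 1 := by
    intro y
    simp only [P, h0]
    exact ⟨fun h => h.1, fun h => ⟨h, hneg _ _⟩⟩
  obtain ⟨x₀, hx₀⟩ := Int.eq_ofNat_of_zero_le (hx0 0 (Nat.zero_le L))
  have hx₀m : x₀ ≤ m := by have := hp0.1; omega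
  obtain ⟨s, hs, hc, hQs⟩ := exists_marked_edge_top L (m + 1) P
    (fun s y => Q ((y : ℤ) - 1, max (p s).2 (p (s + 1)).2)) (fun s y => Q ((y : ℤ), (p s).2))
    (by
      intro s hs y hy
      refine ⟨Q ((y : ℤ), max (p s).2 (p (s + 1)).2), ?_, ?_, ?_, ?_⟩
      · intro hc
        have hub : IsPartial F m (k + 1) ((y : ℤ), max (p s).2 (p (s + 1)).2) := by
          by_cases h1 : P s y ↔ P s (y + 1)
          · by_cases h2 : P (s + 1) y ↔ P (s + 1) (y + 1)
            · have := hhor s hs (y + 1) (by omega)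
                fun e => hc (h1.trans (e.trans h2.symm))
              simpa using this
            · exact (hhub s hs y hy (s + 1) (Or.inr rfl) h2).2.1
          · exact (hhub s hs y hy s (Or.inl rfl) h1).2.1
        exact hQ _ _ ⟨hhor s hs y (by omega) hc, hub, by simp⟩
      · intro _
        have e : (((y + 1 : ℕ) : ℤ)) - 1 = (y : ℤ) := by push_cast; ring
        rw [e]
      · exact fun hc => hQ _ _ (hhub s hs y hy s (Or.inl rfl) hc)
      · exact fun hc => hQ _ _ (hhub s hs y hy (s + 1) (Or.inr rfl) hc))
    (by
      intro s hs
      have h1 := hx0 s hs.le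
      have h2 := hx0 (s + 1) hs
      simp only [P, Nat.cast_zero]
      constructor <;> rintro ⟨_, _⟩ <;> omega)
    (by
      intro y hy
      simp [hend y (by omega), hend (y + 1) (by omega)])
    x₀ (by omega)
    (by
      intro y hy
      rw [hP0, hP0, hx₀]
      push_cast
      simp only [add_sub_cancel_right]
      constructor
      · intro hc
        by_contra hne
        exact hc (by constructor <;> intro _ <;> omega)
      · rintro rfl
        intro hc
        have := hc.2 le_rfl
        omega)
    (by
      simp only [Q, h0, hx₀]
      exact .refl)
  refine ⟨((p 0).1, 0), _, rfl, hstart, hQs, ?_⟩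
  simp

/-- For agents with non-positive values, and values `0` of empty bundles, some threshold is shared
by all bundles of a suitable partition into intervals. -/
theorem exists_reach {F : ℕ → ℤ → ℤ → ℤ} {n m : ℕ} (hn : 0 < n)
    (hF : ∀ k x y, y ≤ x → F k x y = 0) (hneg : ∀ k x y, F k x y ≤ 0)
    (hbdd : ∀ k, ∃ B : ℕ, ∀ x y, -(B : ℤ) ≤ F k x y) :
    ∃ τ, Reach F τ n m := by
  suffices H : ∀ k, ∃ a b : ℤ × ℤ, a.2 = 0 ∧ IsPartial F m (k + 1) a ∧
      Relation.ReflTransGen (Linked F m (k + 1)) a b ∧ b.1 = m by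
    obtain ⟨a, b, -, hpa, hab, hb⟩ := H (n - 1)
    rw [Nat.sub_add_cancel hn] at hpa hab
    refine ⟨b.2, ?_⟩
    rcases Relation.ReflTransGen.cases_tail hab with h | ⟨c, -, hc⟩
    · rw [← hb, h]; exact hpa.2.2
    · rw [← hb]; exact hc.2.1.2.2
  intro k
  induction k with
  | zero =>
    obtain ⟨B, hB⟩ := hbdd 0
    have hp : ∀ j : ℕ, IsPartial F m 0 (0, -(j : ℤ)) := fun j =>
      ⟨by simp, by simp, rfl⟩
    have hline : ∀ j : ℕ, Relation.ReflTransGen (Linked F m 0) (0, 0) (0, -(j : ℤ)) := by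
      intro j
      induction j with
      | zero => exact .refl
      | succ j ih => exact ih.tail ⟨hp j, hp (j + 1), by simp⟩
    refine exists_linked_succ (hF 0) (hneg 0) rfl (hp 0) (hline (B + 1)) (Or.inr fun x y => ?_)
    have := hB x y
    push_cast
    omega
  | succ k ih =>
    obtain ⟨a, b, ha, hpa, hab, hb⟩ := ih
    exact exists_linked_succ (hF _) (hneg _) ha hpa hab (Or.inl hb)

/-! ### From cut sequences to allocations -/

theorem mem_interval {m : ℕ} {l r : ℤ} {k : Fin m} :
    k ∈ interval m l r ↔ l ≤ (k : ℤ) ∧ (k : ℤ) ≤ r := by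
  simp [interval]

theorem interval_eq_empty {m : ℕ} {l r : ℤ} (h : r < l) : interval m l r = ∅ := by
  ext k
  simp only [mem_interval, Finset.notMem_empty, iff_false]
  omega

theorem isConnectedBundle_interval (m : ℕ) (l r : ℤ) : IsConnectedBundle (interval m l r) := by
  let G := (SimpleGraph.pathGraph m).induce (interval m l r : Set (Fin m))
  have up : ∀ (d : ℕ) (a b : (interval m l r : Set (Fin m))), (a.1 : ℕ) + d = b.1 →
      G.Reachable a b := by
    intro d
    induction d with
    | zero =>
      intro a b h
      obtain rfl : a = b := Subtype.ext (Fin.ext (by omega))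
      exact .refl _
    | succ d ih =>
      intro a b h
      have ha := mem_interval.1 (Finset.mem_coe.1 a.2)
      have hb := mem_interval.1 (Finset.mem_coe.1 b.2)
      let c : (interval m l r : Set (Fin m)) := ⟨⟨(a.1 : ℕ) + d, by omega⟩, by
        rw [Finset.mem_coe, mem_interval]
        push_cast
        constructor <;> omega⟩
      refine (ih a c rfl).trans (SimpleGraph.Adj.reachable ?_)
      rw [SimpleGraph.comap_adj, SimpleGraph.pathGraph_adj]
      left
      simp [c]
      omega
  intro a b
  rcases le_total (a.1 : ℕ) b.1 with h | h
  · exact up (b.1 - a.1) a b (by omega)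
  · exact (up (a.1 - b.1) b a (by omega)).symm

/-- The cuts `0 = c 0 ≤ c 1 ≤ … ≤ c n = m` divide the items among the agents `0, …, n - 1` so that
`τ` is a common threshold for the bundles `{c j, …, c (j + 1) - 1}`. -/
structure IsCutSequence (F : ℕ → ℤ → ℤ → ℤ) (τ : ℤ) (n : ℕ) (m : ℤ) (c : ℕ → ℤ) : Prop where
  zero : c 0 = 0
  last : c n = m
  mono : ∀ j < n, c j ≤ c (j + 1)
  good : ∀ j < n, Good (F j) τ (c j) (c (j + 1))

theorem Reach.exists_isCutSequence {F : ℕ → ℤ → ℤ → ℤ} {τ : ℤ} :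
    ∀ {n : ℕ} {m : ℤ}, Reach F τ n m → ∃ c, IsCutSequence F τ n m c
  | 0, m, h => ⟨fun _ => 0, rfl, Eq.symm h, by simp, by simp⟩
  | n + 1, m, ⟨x, hx, hr, hg⟩ => by
    obtain ⟨c, h0, hl, hm, hgood⟩ := hr.exists_isCutSequence
    refine ⟨fun j => if j ≤ n then c j else m, by simp [h0], by simp, ?_, ?_⟩
    · intro j hj
      rcases Nat.lt_or_ge j n with h | h
      · have h' : j + 1 ≤ n := h
        simpa [h.le, h'] using hm j h
      · obtain rfl : j = n := by omega
        simpa [hl] using hx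
    · intro j hj
      rcases Nat.lt_or_ge j n with h | h
      · have h' : j + 1 ≤ n := h
        simpa [h.le, h'] using hgood j h
      · obtain rfl : j = n := by omega
        simpa [hl] using hg

namespace IsCutSequence

variable {F : ℕ → ℤ → ℤ → ℤ} {τ m : ℤ} {n : ℕ} {c : ℕ → ℤ}

theorem le (h : IsCutSequence F τ n m c) {i j : ℕ} (hij : i ≤ j) (hj : j ≤ n) : c i ≤ c j := by
  induction j, hij using Nat.le_induction with
  | base => exact le_rfl
  | succ j hij ih => exact (ih (by omega)).trans (h.mono j (by omega))

theorem reach (h : IsCutSequence F τ n m c) : Reach F τ n m := by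
  have : ∀ j ≤ n, Reach F τ j (c j) := by
    intro j hj
    induction j with
    | zero => exact h.zero
    | succ j ih => exact ⟨c j, h.mono j hj, ih (by omega), h.good j hj⟩
  exact h.last ▸ this n le_rfl

theorem exists_index (h : IsCutSequence F τ n m c) {k : ℤ} (h0 : 0 ≤ k) (hk : k < m) :
    ∃ i < n, c i ≤ k ∧ k < c (i + 1) := by
  have : ∀ j ≤ n, k < c j → ∃ i < n, c i ≤ k ∧ k < c (i + 1) := by
    intro j hj hkj
    induction j with
    | zero => rw [h.zero] at hkj; omega
    | succ j ih =>
      rcases le_or_gt (c j) k with h' | h'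
      · exact ⟨j, hj, h', hkj⟩
      · exact ih (by omega) h'
  exact this n le_rfl (h.last ▸ hk)

theorem index_unique (h : IsCutSequence F τ n m c) {k : ℤ} {i j : ℕ} (hi : i < n) (hj : j < n)
    (hi' : c i ≤ k ∧ k < c (i + 1)) (hj' : c j ≤ k ∧ k < c (j + 1)) : i = j := by
  rcases lt_trichotomy i j with h' | h' | h'
  · have := h.le (show i + 1 ≤ j from h') hj.le
    omega
  · exact h'
  · have := h.le (show j + 1 ≤ i from h') hi.le
    omega

end IsCutSequence

/-- A common threshold can be chosen among the values of intervals: the largest one of the lower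
bounds that the bundles impose. -/
theorem Reach.exists_eq_value {F : ℕ → ℤ → ℤ → ℤ} {τ : ℤ} {n : ℕ} {m : ℤ} (hn : 0 < n)
    (hF : ∀ k x y, y ≤ x → F k x y = 0) (h : Reach F τ n m) :
    ∃ i < n, ∃ x y, 0 ≤ x ∧ x ≤ m ∧ 0 ≤ y ∧ y ≤ m ∧ Reach F (F i x y) n m := by
  obtain ⟨c, hc⟩ := h.exists_isCutSequence
  let g : ℕ → ℤ := fun j => min (F j (c j) (c (j + 1)))
    (min (F j (c j + 1) (c (j + 1))) (F j (c j) (c (j + 1) - 1)))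
  obtain ⟨i, hi, hmax⟩ := Finset.exists_max_image (Finset.range n) g ⟨0, Finset.mem_range.2 hn⟩
  rw [Finset.mem_range] at hi
  have hcut : IsCutSequence F (g i) n m c := by
    refine ⟨hc.zero, hc.last, hc.mono, fun j hj => ?_⟩
    have h1 := hmax j (Finset.mem_range.2 hj)
    have h2 := (hc.good j hj).2
    have h3 := (hc.good i hi).1
    have h4 : g i ≤ τ := by simp only [g, min_le_iff]; exact h3
    simp only [g, min_le_iff] at h1
    exact ⟨h1, by omega⟩
  have h0 : 0 ≤ c i := hc.zero ▸ hc.le (Nat.zero_le i) hi.le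
  have hm : c (i + 1) ≤ m := hc.last ▸ hc.le (show i + 1 ≤ n from hi) le_rfl
  have hval : ∃ x y, 0 ≤ x ∧ x ≤ m ∧ 0 ≤ y ∧ y ≤ m ∧ g i = F i x y := by
    rcases eq_or_lt_of_le (hc.mono i hi) with he | hlt
    · refine ⟨c i, c i, h0, by omega, h0, by omega, ?_⟩
      simp only [g, ← he]
      rw [hF i _ _ le_rfl, hF i _ _ (by omega), hF i _ _ (by omega)]
      simp
    · have : g i = F i (c i) (c (i + 1)) ∨ g i = F i (c i + 1) (c (i + 1)) ∨
          g i = F i (c i) (c (i + 1) - 1) := by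
        simp only [g]
        omega
      rcases this with e | e | e
      · exact ⟨_, _, h0, by omega, by omega, hm, e⟩
      · exact ⟨_, _, by omega, by omega, by omega, hm, e⟩
      · exact ⟨_, _, h0, by omega, by omega, by omega, e⟩
  obtain ⟨x, y, h1, h2, h3, h4, e⟩ := hval
  exact ⟨i, hi, x, y, h1, h2, h3, h4, e ▸ hcut.reach⟩

/-- The value of the items `x, …, y - 1` for agent `k`, as reported by the oracle `O`. -/
def value (O : ℤ → ℤ → ℤ → ℤ) (k : ℕ) (x y : ℤ) : ℤ := O k x (y - 1)

section Oracle

variable {n m : ℕ} {v : Fin n → Finset (Fin m) → ℤ}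

theorem value_oracle (i : Fin n) (x y : ℤ) :
    value (oracle v) i x y = v i (interval m x (y - 1)) := by
  simp [value, oracle]

theorem value_oracle_of_le (hv : IsValuation v) (k : ℕ) (x y : ℤ) (h : y ≤ x) :
    value (oracle v) k x y = 0 := by
  unfold value oracle
  split_ifs
  · rw [interval_eq_empty (by omega), hv]
  · rfl

theorem value_oracle_nonpos (hv : IsNonpositive v) (k : ℕ) (x y : ℤ) :
    value (oracle v) k x y ≤ 0 := by
  unfold value oracle
  split_ifs
  · exact hv _ _
  · exact le_rfl

theorem value_oracle_bddBelow (v : Fin n → Finset (Fin m) → ℤ) (k : ℕ) :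
    ∃ B : ℕ, ∀ x y, -(B : ℤ) ≤ value (oracle v) k x y := by
  by_cases hk : k < n
  · obtain ⟨b, hb⟩ := (Set.finite_range (v ⟨k, hk⟩)).bddBelow
    refine ⟨b.natAbs, fun x y => ?_⟩
    have h1 := hb ⟨interval m x (y - 1), rfl⟩
    have h2 := value_oracle (v := v) ⟨k, hk⟩ x y
    simp only at h2
    rw [h2]
    omega
  · exact ⟨0, fun x y => by simp [value, oracle, hk]⟩

/-- A removal of at most one item brings the bundle to a value not above the threshold, and another
one to a value not below it. -/
theorem Good.exists_removal {i : Fin n} {τ x y : ℤ} (h : Good (value (oracle v) i) τ x y) :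
    (∃ X ⊆ interval m x (y - 1), X.card ≤ 1 ∧ IsConnectedBundle (interval m x (y - 1) \ X) ∧
      v i (interval m x (y - 1) \ X) ≤ τ) ∧
    (∃ X ⊆ interval m x (y - 1), X.card ≤ 1 ∧ IsConnectedBundle (interval m x (y - 1) \ X) ∧
      τ ≤ v i (interval m x (y - 1) \ X)) := by
  have rem : ∀ x' y' : ℤ, (x' = x ∧ y' = y) ∨ (x' = x + 1 ∧ y' = y) ∨ (x' = x ∧ y' = y - 1) →
      ∃ X ⊆ interval m x (y - 1), X.card ≤ 1 ∧ IsConnectedBundle (interval m x (y - 1) \ X) ∧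
        v i (interval m x (y - 1) \ X) = value (oracle v) i x' y' := by
    intro x' y' hxy
    refine ⟨interval m x (y - 1) \ interval m x' (y' - 1), Finset.sdiff_subset, ?_, ?_⟩
    · rw [Finset.card_le_one]
      intro a ha b hb
      simp only [Finset.mem_sdiff, mem_interval] at ha hb
      apply Fin.ext
      omega
    · have e : interval m x (y - 1) \ (interval m x (y - 1) \ interval m x' (y' - 1)) =
          interval m x' (y' - 1) := by
        rw [Finset.sdiff_sdiff_eq_self]
        intro a ha
        simp only [mem_interval] at ha ⊢
        omega
      rw [e, value_oracle]
      exact ⟨isConnectedBundle_interval _ _ _, rfl⟩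
  obtain ⟨h1, h2⟩ := h
  constructor
  · rcases h1 with h | h | h
    · obtain ⟨X, a, b, c, d⟩ := rem x y (by simp)
      exact ⟨X, a, b, c, d ▸ h⟩
    · obtain ⟨X, a, b, c, d⟩ := rem (x + 1) y (by simp)
      exact ⟨X, a, b, c, d ▸ h⟩
    · obtain ⟨X, a, b, c, d⟩ := rem x (y - 1) (by simp)
      exact ⟨X, a, b, c, d ▸ h⟩
  · rcases h2 with h | h | h
    · obtain ⟨X, a, b, c, d⟩ := rem x y (by simp)
      exact ⟨X, a, b, c, d ▸ h⟩
    · obtain ⟨X, a, b, c, d⟩ := rem (x + 1) y (by simp)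
      exact ⟨X, a, b, c, d ▸ h⟩
    · obtain ⟨X, a, b, c, d⟩ := rem x (y - 1) (by simp)
      exact ⟨X, a, b, c, d ▸ h⟩

/-- The allocation that gives to agent `i` the items between the cuts `c i` and `c (i + 1)`. -/
def cutAllocation (n m : ℕ) (c : ℕ → ℤ) (i : Fin n) : Finset (Fin m) :=
  interval m (c i) (c (i + 1) - 1)

theorem mem_cutAllocation {c : ℕ → ℤ} {i : Fin n} {k : Fin m} :
    k ∈ cutAllocation n m c i ↔ c i ≤ (k : ℤ) ∧ (k : ℤ) < c (i + 1) := by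
  rw [cutAllocation, mem_interval, Int.le_sub_one_iff]

theorem IsEQ1Pgc.isEQ1gc {A : Fin n → Finset (Fin m)} (h : IsEQ1Pgc v A) : IsEQ1gc v A := by
  intro i j hij
  obtain ⟨X, h1, h2, -, -, h3⟩ := h.2 i j hij
  exact ⟨X, h1, h2, h3⟩

namespace IsCutSequence

variable {τ : ℤ} {c : ℕ → ℤ}

theorem isAllocation {F : ℕ → ℤ → ℤ → ℤ} (h : IsCutSequence F τ n m c) :
    IsAllocation (cutAllocation n m c) := by
  intro k
  obtain ⟨i, hi, h1⟩ := h.exists_index (k := (k : ℤ)) (by omega) (by omega)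
  refine ⟨⟨i, hi⟩, mem_cutAllocation.2 h1, fun j hj => ?_⟩
  exact Fin.ext (h.index_unique j.2 hi (mem_cutAllocation.1 hj) h1)

/-- The items removed from the two bundles can be chosen independently, since the bundles are
disjoint; the common threshold then separates the remaining values. -/
theorem isEQ1Pgc (h : IsCutSequence (value (oracle v)) τ n m c) :
    IsEQ1Pgc v (cutAllocation n m c) := by
  refine ⟨fun i => isConnectedBundle_interval _ _ _, fun i j hij => ?_⟩
  have hne : i ≠ j := by rintro rfl; exact lt_irrefl _ hij
  have hdisj : Disjoint (cutAllocation n m c i) (cutAllocation n m c j) := by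
    rw [Finset.disjoint_left]
    intro k hi hj
    exact hne (Fin.ext (h.index_unique i.2 j.2 (mem_cutAllocation.1 hi) (mem_cutAllocation.1 hj)))
  obtain ⟨X, hX, hX1, hXc, hXv⟩ := (h.good i i.2).exists_removal.2
  obtain ⟨Y, hY, hY1, hYc, hYv⟩ := (h.good j j.2).exists_removal.1
  change X ⊆ cutAllocation n m c i at hX
  change Y ⊆ cutAllocation n m c j at hY
  have ei : cutAllocation n m c i ∩ (X ∪ Y) = X := by
    rw [Finset.inter_union_distrib_left, Finset.inter_eq_right.2 hX,
      Finset.disjoint_iff_inter_eq_empty.1 (hdisj.mono_right hY), Finset.union_empty]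
  have ej : cutAllocation n m c j ∩ (X ∪ Y) = Y := by
    rw [Finset.inter_union_distrib_left, Finset.inter_eq_right.2 hY,
      Finset.disjoint_iff_inter_eq_empty.1 (hdisj.symm.mono_right hX), Finset.empty_union]
  have di : cutAllocation n m c i \ (X ∪ Y) = cutAllocation n m c i \ X := by
    rw [← Finset.sdiff_inter_self_left, ei]
  have dj : cutAllocation n m c j \ (X ∪ Y) = cutAllocation n m c j \ Y := by
    rw [← Finset.sdiff_inter_self_left, ej]
  refine ⟨X ∪ Y, by rwa [ei], by rwa [ej], ?_⟩
  rw [di, dj]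
  exact ⟨hXc, hYc, hYv.trans hXv⟩

end IsCutSequence

/-- Some interval value is a threshold for which a partition into intervals exists. -/
theorem exists_value_reach (hn : 0 < n) (hv : IsValuation v) (hneg : IsNonpositive v) :
    ∃ i < n, ∃ x y : ℤ, 0 ≤ x ∧ x ≤ m ∧ 0 ≤ y ∧ y ≤ m ∧
      Reach (value (oracle v)) (value (oracle v) i x y) n m := by
  obtain ⟨τ, hτ⟩ := exists_reach (F := value (oracle v)) (m := m) hn (value_oracle_of_le hv)
    (value_oracle_nonpos hneg) (value_oracle_bddBelow v)
  exact hτ.exists_eq_value hn (value_oracle_of_le hv)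

end Oracle

/-! ### Reasoning about programs and their running time -/

@[simp]
theorem State.reg_setReg (s : State) (x y : ℕ) (c : ℤ) :
    (s.setReg x c).reg y = if y = x then c else s.reg y := by
  simp [State.setReg, Function.update_apply]

@[simp]
theorem State.arr_setReg (s : State) (x : ℕ) (c : ℤ) : (s.setReg x c).arr = s.arr := rfl

@[simp]
theorem State.reg_setArr (s : State) (a : ℕ) (k c : ℤ) : (s.setArr a k c).reg = s.reg := rfl

@[simp]
theorem State.arr_setArr (s : State) (a b : ℕ) (k c : ℤ) :
    (s.setArr a k c).arr b = if b = a then Function.update (s.arr a) k c else s.arr b := by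
  by_cases h : b = a
  · subst h; simp [State.setArr]
  · simp [State.setArr, h]

namespace Prog

/-- The registers that occur as targets in the program. -/
def regs : Prog → List ℕ
  | skip => []
  | const x _ => [x]
  | add x _ _ => [x]
  | sub x _ _ => [x]
  | load x _ _ => [x]
  | store _ _ _ => []
  | query x _ _ _ => [x]
  | seq p q => p.regs ++ q.regs
  | ifLt _ _ p q => p.regs ++ q.regs
  | whileLt _ _ p => p.regs

/-- The arrays that occur as targets in the program. -/
def arrs : Prog → List ℕ
  | store a _ _ => [a]
  | seq p q => p.arrs ++ q.arrs
  | ifLt _ _ p q => p.arrs ++ q.arrs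
  | whileLt _ _ p => p.arrs
  | _ => []

end Prog

/-- The states `s` and `s'` differ at most in the registers and arrays to which `p` writes. -/
def Frame (p : Prog) (s s' : State) : Prop :=
  (∀ x ∉ p.regs, s'.reg x = s.reg x) ∧ ∀ a ∉ p.arrs, s'.arr a = s.arr a

theorem Frame.refl (p : Prog) (s : State) : Frame p s s := ⟨fun _ _ => rfl, fun _ _ => rfl⟩

theorem Frame.trans {p : Prog} {s s' s'' : State} (h : Frame p s s') (h' : Frame p s' s'') :
    Frame p s s'' :=
  ⟨fun x hx => (h'.1 x hx).trans (h.1 x hx), fun a ha => (h'.2 a ha).trans (h.2 a ha)⟩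

theorem Frame.mono {p q : Prog} {s s' : State} (h : Frame p s s') (hr : p.regs ⊆ q.regs)
    (ha : p.arrs ⊆ q.arrs) : Frame q s s' :=
  ⟨fun x hx => h.1 x fun hx' => hx (hr hx'), fun a hx => h.2 a fun hx' => hx (ha hx')⟩

section Exec

variable {O : ℤ → ℤ → ℤ → ℤ}

theorem Exec.frame {p : Prog} {s s' : State} {t : ℕ} (h : Exec O p s t s') : Frame p s s' := by
  induction h with
  | skip s => exact .refl _ _
  | const s x c => exact ⟨fun y hy => by simp [Prog.regs] at hy; simp [hy], fun a _ => rfl⟩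
  | add s x y z => exact ⟨fun y hy => by simp [Prog.regs] at hy; simp [hy], fun a _ => rfl⟩
  | sub s x y z => exact ⟨fun y hy => by simp [Prog.regs] at hy; simp [hy], fun a _ => rfl⟩
  | load s x a y => exact ⟨fun y hy => by simp [Prog.regs] at hy; simp [hy], fun a _ => rfl⟩
  | store s a y x => exact ⟨fun y _ => rfl, fun b hb => by simp [Prog.arrs] at hb; simp [hb]⟩
  | query s x i l r => exact ⟨fun y hy => by simp [Prog.regs] at hy; simp [hy], fun a _ => rfl⟩
  | seq _ _ ih ih' =>
    exact (ih.mono (List.subset_append_left _ _) (List.subset_append_left _ _)).trans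
      (ih'.mono (List.subset_append_right _ _) (List.subset_append_right _ _))
  | ifTrue _ _ ih => exact ih.mono (List.subset_append_left _ _) (List.subset_append_left _ _)
  | ifFalse _ _ ih => exact ih.mono (List.subset_append_right _ _) (List.subset_append_right _ _)
  | whileTrue _ _ _ ih ih' => exact Frame.trans (p := .whileLt _ _ _) ih ih'
  | whileFalse _ => exact .refl _ _

/-- Started in `s`, the program `p` halts within `T` steps in a state that satisfies `Q`. -/
def RunsIn (O : ℤ → ℤ → ℤ → ℤ) (p : Prog) (s : State) (T : ℕ) (Q : State → Prop) : Prop :=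
  ∃ t s', Exec O p s t s' ∧ t ≤ T ∧ Q s'

namespace RunsIn

variable {p q : Prog} {s : State} {T T' : ℕ} {Q R : State → Prop}

theorem mono (h : RunsIn O p s T Q) (hT : T ≤ T') (hQ : ∀ s', Q s' → R s') :
    RunsIn O p s T' R := by
  obtain ⟨t, s', h, ht, hq⟩ := h
  exact ⟨t, s', h, ht.trans hT, hQ s' hq⟩

theorem seq (hp : RunsIn O p s T R)
    (hq : ∀ s', Frame p s s' → R s' → RunsIn O q s' T' Q) :
    RunsIn O (.seq p q) s (T + T') Q := by
  obtain ⟨t, s', h, ht, hr⟩ := hp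
  obtain ⟨t', s'', h', ht', hQ⟩ := hq s' h.frame hr
  exact ⟨t + t', s'', .seq h h', by omega, hQ⟩

theorem skip (h : Q s) : RunsIn O .skip s 1 Q := ⟨1, s, .skip s, le_rfl, h⟩

theorem add {x y z : ℕ} (h : Q (s.setReg x (s.reg y + s.reg z))) :
    RunsIn O (.add x y z) s 1 Q := ⟨1, _, .add s x y z, le_rfl, h⟩

theorem store {a y x : ℕ} (h : Q (s.setArr a (s.reg y) (s.reg x))) :
    RunsIn O (.store a y x) s 1 Q := ⟨1, _, .store s a y x, le_rfl, h⟩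

theorem const_seq {x : ℕ} {c : ℤ} (h : RunsIn O q (s.setReg x c) T Q) :
    RunsIn O (.seq (.const x c) q) s (1 + T) Q := by
  obtain ⟨t, s', h, ht, hq⟩ := h
  exact ⟨1 + t, s', .seq (.const s x c) h, by omega, hq⟩

theorem add_seq {x y z : ℕ} (h : RunsIn O q (s.setReg x (s.reg y + s.reg z)) T Q) :
    RunsIn O (.seq (.add x y z) q) s (1 + T) Q := by
  obtain ⟨t, s', h, ht, hq⟩ := h
  exact ⟨1 + t, s', .seq (.add s x y z) h, by omega, hq⟩

theorem sub_seq {x y z : ℕ} (h : RunsIn O q (s.setReg x (s.reg y - s.reg z)) T Q) :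
    RunsIn O (.seq (.sub x y z) q) s (1 + T) Q := by
  obtain ⟨t, s', h, ht, hq⟩ := h
  exact ⟨1 + t, s', .seq (.sub s x y z) h, by omega, hq⟩

theorem load_seq {x a y : ℕ} (h : RunsIn O q (s.setReg x (s.arr a (s.reg y))) T Q) :
    RunsIn O (.seq (.load x a y) q) s (1 + T) Q := by
  obtain ⟨t, s', h, ht, hq⟩ := h
  exact ⟨1 + t, s', .seq (.load s x a y) h, by omega, hq⟩

theorem store_seq {a y x : ℕ} (h : RunsIn O q (s.setArr a (s.reg y) (s.reg x)) T Q) :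
    RunsIn O (.seq (.store a y x) q) s (1 + T) Q := by
  obtain ⟨t, s', h, ht, hq⟩ := h
  exact ⟨1 + t, s', .seq (.store s a y x) h, by omega, hq⟩

theorem query_seq {x i l r : ℕ}
    (h : RunsIn O q (s.setReg x (O (s.reg i) (s.reg l) (s.reg r))) T Q) :
    RunsIn O (.seq (.query x i l r) q) s (1 + T) Q := by
  obtain ⟨t, s', h, ht, hq⟩ := h
  exact ⟨1 + t, s', .seq (.query s x i l r) h, by omega, hq⟩

theorem ifLt {x y : ℕ} (hp : s.reg x < s.reg y → RunsIn O p s T Q)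
    (hq : ¬s.reg x < s.reg y → RunsIn O q s T Q) : RunsIn O (.ifLt x y p q) s (T + 1) Q := by
  by_cases h : s.reg x < s.reg y
  · obtain ⟨t, s', h', ht, hQ⟩ := hp h
    exact ⟨t + 1, s', .ifTrue h h', by omega, hQ⟩
  · obtain ⟨t, s', h', ht, hQ⟩ := hq h
    exact ⟨t + 1, s', .ifFalse h h', by omega, hQ⟩

/-- A loop with exactly `N` rounds of at most `T` steps each; `I j` holds after `j` rounds. -/
theorem whileLt {x y : ℕ} {I : ℕ → State → Prop} (N : ℕ) (h0 : I 0 s)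
    (hstep : ∀ j < N, ∀ s', Frame p s s' → I j s' →
      s'.reg x < s'.reg y ∧ RunsIn O p s' T (I (j + 1)))
    (hend : ∀ s', Frame p s s' → I N s' → ¬s'.reg x < s'.reg y) :
    RunsIn O (.whileLt x y p) s (N * (T + 1) + 1) (I N) := by
  have main : ∀ d ≤ N, ∀ s', Frame p s s' → I (N - d) s' →
      RunsIn O (.whileLt x y p) s' (d * (T + 1) + 1) (I N) := by
    intro d
    induction d with
    | zero =>
      intro _ s' hf hs'
      exact ⟨1, s', .whileFalse (hend s' hf hs'), by omega, hs'⟩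
    | succ d ih =>
      intro hd s' hf hs'
      obtain ⟨hlt, t, s₁, h₁, ht, hi⟩ := hstep _ (by omega) s' hf hs'
      have e : N - (d + 1) + 1 = N - d := by omega
      rw [e] at hi
      obtain ⟨t', s₂, h₂, ht', hQ⟩ := ih (by omega) s₁ (hf.trans h₁.frame) hi
      refine ⟨t + t' + 1, s₂, .whileTrue hlt h₁ h₂, ?_, hQ⟩
      rw [add_mul, one_mul]
      omega
  exact main N le_rfl s (.refl _ _) (by simpa using h0)

end RunsIn

end Exec

/-! ### The program -/

namespace Prog

/-- If the threshold is good for the bundle `{x, …, y - 1}` of agent `k`, enter `x` into the current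
cell of the table. Three values are queried; the comparison with the largest one is made only if
some value is at most the threshold. -/
def testBundle : Prog :=
  .seq (.sub 18 13 2) <| .seq (.query 19 10 15 18) <| .seq (.add 22 15 2) <|
  .seq (.query 20 10 22 18) <| .seq (.sub 22 18 2) <| .seq (.query 21 10 15 22) <|
  .ifLt 9 19 (.ifLt 9 20 (.ifLt 9 21 .skip testUpper) testUpper) testUpper
where
  /-- The entry is made if some value is at least the threshold. -/
  testUpper : Prog := .ifLt 19 9 (.ifLt 20 9 (.ifLt 21 9 .skip enter) enter) enter
  /-- The entry of `x` into the current cell. -/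
  enter : Prog := .store 1 14 15

/-- Try the position `x` as the left end of the bundle of agent `k`, and increase `x`. -/
def tryLeftEnd : Prog :=
  .seq (.add 16 11 15) <| .seq (.load 17 1 16) <| .seq (.ifLt 5 17 testBundle .skip) <|
  .add 15 15 2

/-- Compute the table cell of `k + 1` agents and `y` items, and increase `y`. -/
def fillCell : Prog :=
  .seq (.add 14 12 13) <| .seq (.store 1 14 5) <| .seq (.const 15 0) <| .seq (.add 23 13 2) <|
  .seq (.whileLt 15 23 tryLeftEnd) <| .add 13 13 2

/-- Compute the table row of `k + 1` agents, and increase `k`. -/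
def fillRow : Prog :=
  .seq (.add 12 11 3) <| .seq (.const 13 0) <| .seq (.whileLt 13 3 fillCell) <|
  .seq (.add 11 12 4) <| .add 10 10 2

/-- Compute the table row of `0` agents. -/
def initRow : Prog :=
  .seq (.const 13 0) <| .seq (.whileLt 13 3 (.seq (.store 1 13 5) (.add 13 13 2))) <|
  .store 1 4 4

/-- Compute the whole table. -/
def fillTable : Prog :=
  .seq initRow <| .seq (.const 10 0) <| .seq (.const 11 0) <| .whileLt 10 0 fillRow

/-- Decrease `k`, look up the left end `x` of the bundle of agent `k` with right end `y`, and
give him the items of this bundle; then `y` is `x`. -/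
def traceAgent : Prog :=
  .seq (.sub 10 10 2) <| .seq (.add 16 11 13) <| .seq (.load 15 1 16) <| .seq (.sub 11 11 3) <|
  .whileLt 15 13 (.seq (.sub 13 13 2) (.store 0 13 10))

/-- If the table shows that all items can be distributed, write down the allocation. -/
def trace : Prog :=
  .seq (.add 16 11 1) <| .seq (.load 17 1 16) <|
  .ifLt 5 17 (.seq (.add 13 1 4) (.whileLt 4 10 traceAgent)) .skip

/-- Try as threshold the value of agent `i` for the items `l, …, r - 1`, and increase `r`. -/
def tryThreshold : Prog :=
  .seq (.sub 18 8 2) <| .seq (.query 9 6 7 18) <| .seq fillTable <| .seq trace <| .add 8 8 2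

/-- The whole algorithm. Registers: `0`: `n`; `1`: `m`; `2`: `1`; `3`: `m + 1`; `4`: `0`;
`5`: `-1`; `6`, `7`, `8`: `i`, `l`, `r`, which determine the threshold; `9`: the threshold;
`10`: the agent `k`; `11`, `12`: the beginnings of rows `k` and `k + 1` of the table;
`13`: `y`; `14`: the current table cell; `15`: `x`; `23`: `y + 1`; the others are auxiliary.
Array `1` holds the table, its row `k` being the cells `k (m + 1), …, k (m + 1) + m`. -/
def solve : Prog :=
  .seq (.const 2 1) <| .seq (.const 4 0) <| .seq (.const 5 (-1)) <| .seq (.add 3 1 2) <|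
  .seq (.const 6 0) <| .whileLt 6 0 <|
    .seq (.const 7 0) <| .seq (.whileLt 7 3 <|
      .seq (.const 8 0) <| .seq (.whileLt 8 3 tryThreshold) <| .add 7 7 2) <| .add 6 6 2

end Prog

/-! ### Correctness of the table -/

/-- The registers that hold the input and the constants. -/
structure Setup (n m : ℕ) (s : State) : Prop where
  r0 : s.reg 0 = n
  r1 : s.reg 1 = m
  r2 : s.reg 2 = 1
  r3 : s.reg 3 = m + 1
  r4 : s.reg 4 = 0
  r5 : s.reg 5 = -1

theorem Setup.frame {n m : ℕ} {p : Prog} {s s' : State} (h : Setup n m s) (hf : Frame p s s')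
    (hp : ∀ x < 6, x ∉ p.regs) : Setup n m s' := by
  obtain ⟨h0, h1, h2, h3, h4, h5⟩ := h
  exact ⟨by rw [hf.1 0 (hp 0 (by omega)), h0], by rw [hf.1 1 (hp 1 (by omega)), h1],
    by rw [hf.1 2 (hp 2 (by omega)), h2], by rw [hf.1 3 (hp 3 (by omega)), h3],
    by rw [hf.1 4 (hp 4 (by omega)), h4], by rw [hf.1 5 (hp 5 (by omega)), h5]⟩

theorem Setup.setReg {n m x : ℕ} {c : ℤ} {s : State} (h : Setup n m s) (hx : 6 ≤ x) :
    Setup n m (s.setReg x c) := by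
  obtain ⟨h0, h1, h2, h3, h4, h5⟩ := h
  constructor <;> rw [State.reg_setReg, if_neg (by omega)] <;> assumption

theorem Setup.setArr {n m a : ℕ} {k c : ℤ} {s : State} (h : Setup n m s) :
    Setup n m (s.setArr a k c) :=
  ⟨h.r0, h.r1, h.r2, h.r3, h.r4, h.r5⟩

/-- Agent `k` can be given the items `x, …, y - 1`, the previous agents sharing the first `x`
items. -/
def IsLeftEnd (F : ℕ → ℤ → ℤ → ℤ) (τ : ℤ) (k : ℕ) (y x : ℤ) : Prop :=
  x ≤ y ∧ Reach F τ k x ∧ Good (F k) τ x y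

/-- The number `e` is a correct entry of the table in row `k` and column `y`: `e` is non-negative
if and only if the first `y` items can be distributed among the first `k` agents, and then, for
`k > 0`, it is the left end of a possible bundle of agent `k - 1`. -/
def EntryOK (F : ℕ → ℤ → ℤ → ℤ) (τ : ℤ) : ℕ → ℤ → ℤ → Prop
  | 0, y, e => -1 < e ↔ y = 0
  | k + 1, y, e => (-1 < e → IsLeftEnd F τ k y e) ∧ (∀ x, IsLeftEnd F τ k y x → -1 < e)

theorem EntryOK.iff {F : ℕ → ℤ → ℤ → ℤ} {τ y e : ℤ} :
    ∀ {k : ℕ}, EntryOK F τ k y e → (-1 < e ↔ Reach F τ k y)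
  | 0, h => h
  | _ + 1, h => ⟨fun he => ⟨e, h.1 he⟩, fun ⟨x, hx⟩ => h.2 x hx⟩

section Exec

variable {O : ℤ → ℤ → ℤ → ℤ} {n m : ℕ} {s : State}

theorem runsIn_testBundle (hs : Setup n m s) {k : ℕ} (hk : s.reg 10 = k) :
    RunsIn O .testBundle s 13 fun s' =>
      (Good (value O k) (s.reg 9) (s.reg 15) (s.reg 13) →
        s'.arr 1 = Function.update (s.arr 1) (s.reg 14) (s.reg 15)) ∧
      (¬Good (value O k) (s.reg 9) (s.reg 15) (s.reg 13) → s'.arr 1 = s.arr 1) := by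
  refine RunsIn.mono (T := 1 + (1 + (1 + (1 + (1 + (1 + 7)))))) ?_ (by norm_num) fun _ => id
  refine .sub_seq <| .query_seq <| .add_seq <| .query_seq <| .sub_seq <| .query_seq ?_
  set a := O (s.reg 10) (s.reg 15) (s.reg 13 - s.reg 2) with ha
  set b := O (s.reg 10) (s.reg 15 + s.reg 2) (s.reg 13 - s.reg 2) with hb
  set c := O (s.reg 10) (s.reg 15) (s.reg 13 - s.reg 2 - s.reg 2) with hc
  have hgood : Good (value O k) (s.reg 9) (s.reg 15) (s.reg 13) ↔
      (a ≤ s.reg 9 ∨ b ≤ s.reg 9 ∨ c ≤ s.reg 9) ∧ (s.reg 9 ≤ a ∨ s.reg 9 ≤ b ∨ s.reg 9 ≤ c) := by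
    simp only [Good, value, ha, hb, hc, hk, hs.r2]
  rw [hgood]
  set s₁ := State.setReg _ 21 _ with hs₁
  have h9 : s₁.reg 9 = s.reg 9 := by simp [hs₁]
  have h19 : s₁.reg 19 = a := by simp [hs₁, ha]
  have h20 : s₁.reg 20 = b := by simp [hs₁, hb]
  have h21 : s₁.reg 21 = c := by simp [hs₁, hc]
  have h14 : s₁.reg 14 = s.reg 14 := by simp [hs₁]
  have h15 : s₁.reg 15 = s.reg 15 := by simp [hs₁]
  have harr : s₁.arr = s.arr := by simp [hs₁]
  clear_value a b c s₁
  have upper : (a ≤ s.reg 9 ∨ b ≤ s.reg 9 ∨ c ≤ s.reg 9) →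
      RunsIn O Prog.testBundle.testUpper s₁ 4 fun s' =>
        (((a ≤ s.reg 9 ∨ b ≤ s.reg 9 ∨ c ≤ s.reg 9) ∧
          (s.reg 9 ≤ a ∨ s.reg 9 ≤ b ∨ s.reg 9 ≤ c)) →
          s'.arr 1 = Function.update (s.arr 1) (s.reg 14) (s.reg 15)) ∧
        (¬((a ≤ s.reg 9 ∨ b ≤ s.reg 9 ∨ c ≤ s.reg 9) ∧
          (s.reg 9 ≤ a ∨ s.reg 9 ≤ b ∨ s.reg 9 ≤ c)) → s'.arr 1 = s.arr 1) := by
    intro hlow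
    have enter : (s.reg 9 ≤ a ∨ s.reg 9 ≤ b ∨ s.reg 9 ≤ c) →
        ∀ T, 1 ≤ T → RunsIn O Prog.testBundle.enter s₁ T fun s' =>
        (((a ≤ s.reg 9 ∨ b ≤ s.reg 9 ∨ c ≤ s.reg 9) ∧
          (s.reg 9 ≤ a ∨ s.reg 9 ≤ b ∨ s.reg 9 ≤ c)) →
          s'.arr 1 = Function.update (s.arr 1) (s.reg 14) (s.reg 15)) ∧
        (¬((a ≤ s.reg 9 ∨ b ≤ s.reg 9 ∨ c ≤ s.reg 9) ∧
          (s.reg 9 ≤ a ∨ s.reg 9 ≤ b ∨ s.reg 9 ≤ c)) → s'.arr 1 = s.arr 1) := by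
      intro hup T hT
      refine RunsIn.mono (RunsIn.store (Q := fun s' =>
        s'.arr 1 = Function.update (s.arr 1) (s.reg 14) (s.reg 15)) ?_) hT ?_
      · simp [h14, h15, harr]
      · exact fun s' h => ⟨fun _ => h, fun hn => absurd ⟨hlow, hup⟩ hn⟩
    refine RunsIn.ifLt (T := 3) (fun h1 => .ifLt (T := 2) (fun h2 => .ifLt (T := 1)
      (fun h3 => .skip ?_) fun h3 => ?_) fun h2 => ?_) fun h1 => ?_
    · rw [h19, h9] at h1
      rw [h20, h9] at h2
      rw [h21, h9] at h3
      exact ⟨fun h => by omega, fun _ => by rw [harr]⟩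
    · rw [h21, h9] at h3
      exact enter (by omega) _ le_rfl
    · rw [h20, h9] at h2
      exact enter (by omega) _ (by norm_num)
    · rw [h19, h9] at h1
      exact enter (by omega) _ (by norm_num)
  refine RunsIn.ifLt (T := 6) (fun h1 => .ifLt (T := 5) (fun h2 => .ifLt (T := 4)
    (fun h3 => ?_) fun h3 => ?_) fun h2 => ?_) fun h1 => ?_
  · rw [h19, h9] at h1
    rw [h20, h9] at h2
    rw [h21, h9] at h3
    refine RunsIn.mono (.skip (Q := fun s' => s'.arr 1 = s.arr 1) (by rw [harr])) (by norm_num) ?_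
    exact fun s' h => ⟨fun h => by omega, fun _ => h⟩
  · rw [h21, h9] at h3
    exact (upper (by omega)).mono le_rfl fun _ => id
  · rw [h20, h9] at h2
    exact (upper (by omega)).mono (by norm_num) fun _ => id
  · rw [h19, h9] at h1
    exact (upper (by omega)).mono (by norm_num) fun _ => id

theorem runsIn_fillCell (hs : Setup n m s) {k y : ℕ} (hy : y ≤ m) {τ base : ℤ}
    (h9 : s.reg 9 = τ) (h10 : s.reg 10 = k) (h11 : s.reg 11 = base)
    (h12 : s.reg 12 = base + (m + 1)) (h13 : s.reg 13 = y)
    (hrow : ∀ z : ℕ, z ≤ m → EntryOK (value O) τ k z (s.arr 1 (base + z))) :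
    RunsIn O .fillCell s (24 * (m + 1)) fun s' =>
      s'.reg 13 = y + 1 ∧ (∀ c, c ≠ base + (m + 1) + y → s'.arr 1 c = s.arr 1 c) ∧
      EntryOK (value O) τ (k + 1) y (s'.arr 1 (base + (m + 1) + y)) := by
  let cell : ℤ := base + (m + 1) + y
  -- After `j` rounds the current cell accounts for the left ends below `j`.
  let I : ℕ → State → Prop := fun j s' =>
    s'.reg 15 = j ∧ (∀ c, c ≠ cell → s'.arr 1 c = s.arr 1 c) ∧
    (-1 < s'.arr 1 cell → IsLeftEnd (value O) τ k y (s'.arr 1 cell)) ∧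
    ∀ x : ℤ, x < j → IsLeftEnd (value O) τ k y x → -1 < s'.arr 1 cell
  refine RunsIn.mono (T := 1 + (1 + (1 + (1 + (((y + 1) * (17 + 1) + 1) + 1))))) ?_
    (by nlinarith) fun _ => id
  refine .add_seq <| .store_seq <| .const_seq <| .add_seq <| .seq (R := I (y + 1)) ?_ ?_
  · refine RunsIn.whileLt (I := I) (y + 1) ?_ ?_ ?_
    · refine ⟨by simp, ?_, ?_, ?_⟩
      · intro c hc
        simp only [State.arr_setReg, State.arr_setArr, if_true]
        rw [Function.update_of_ne]
        simpa [h12, h13] using hc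
      · simp [h12, h13, hs.r5, cell]
      · intro x hx hl
        have := hl.2.1.nonneg
        push_cast at hx
        omega
    · intro j hj s' hf ⟨i15, iarr, iok, iall⟩
      have hs' : Setup n m s' := Setup.frame ((((hs.setReg (by norm_num)).setArr).setReg
        (by norm_num)).setReg (by norm_num)) hf (by decide)
      have f9 : s'.reg 9 = τ := by rw [hf.1 9 (by decide)]; simp [h9]
      have f10 : s'.reg 10 = k := by rw [hf.1 10 (by decide)]; simp [h10]
      have f11 : s'.reg 11 = base := by rw [hf.1 11 (by decide)]; simp [h11]
      have f13 : s'.reg 13 = y := by rw [hf.1 13 (by decide)]; simp [h13]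
      have f14 : s'.reg 14 = cell := by rw [hf.1 14 (by decide)]; simp [h12, h13, cell]
      have f23 : s'.reg 23 = y + 1 := by rw [hf.1 23 (by decide)]; simp [h13, hs.r2]
      refine ⟨by rw [i15, f23]; omega, ?_⟩
      refine RunsIn.mono (T := 1 + (1 + ((13 + 1) + 1))) ?_ (by norm_num) fun _ => id
      have hparent : s'.arr 1 (base + j) = s.arr 1 (base + j) :=
        iarr _ (by simp only [cell]; omega)
      have hreach : -1 < s'.arr 1 (base + j) ↔ Reach (value O) τ k j := by
        rw [hparent]
        exact (hrow j (by omega)).iff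
      refine .add_seq <| .load_seq <| .seq (R := fun t => t.reg 15 = j ∧
        (IsLeftEnd (value O) τ k y j → t.arr 1 = Function.update (s'.arr 1) cell j) ∧
        (¬IsLeftEnd (value O) τ k y j → t.arr 1 = s'.arr 1)) ?_ ?_
      · refine RunsIn.ifLt (fun hlt => ?_) (fun hlt => RunsIn.mono (T := 1) (.skip
          (Q := fun t => t.reg 15 = j ∧ t.arr 1 = s'.arr 1) (by simp [i15])) (by norm_num) ?_)
        · obtain ⟨t, s₁, hex, ht, hq⟩ := runsIn_testBundle (O := O)
            ((hs'.setReg (x := 16) (c := s'.reg 11 + s'.reg 15) (by norm_num)).setReg (x := 17)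
              (c := (s'.setReg 16 (s'.reg 11 + s'.reg 15)).arr 1
                ((s'.setReg 16 (s'.reg 11 + s'.reg 15)).reg 16)) (by norm_num))
            (k := k) (by simp [f10])
          refine ⟨t, s₁, hex, ht, ?_, ?_⟩
          · rw [hex.frame.1 15 (by decide)]
            simp [i15]
          · simp [f9, i15, f13, f14] at hq
            simp [f11, i15, hs'.r5] at hlt
            have hiff : IsLeftEnd (value O) τ k y j ↔ Good (value O k) τ j y :=
              ⟨fun h => h.2.2, fun h => ⟨by omega, hreach.1 hlt, h⟩⟩
            rw [hiff]
            exact hq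
        · rintro t ⟨h1, h2⟩
          refine ⟨h1, fun h => absurd (hreach.2 h.2.1) ?_, fun _ => h2⟩
          simpa [f11, i15, hs'.r5] using hlt
      · rintro t hft ⟨t15, tyes, tno⟩
        have t2 : t.reg 2 = 1 := by rw [hft.1 2 (by decide)]; simp [hs'.r2]
        refine .add ⟨by simp [t15, t2], ?_⟩
        simp only [State.arr_setReg]
        by_cases hl : IsLeftEnd (value O) τ k y j
        · rw [tyes hl]
          refine ⟨fun c hc => by rw [Function.update_of_ne hc, iarr c hc], ?_, ?_⟩
          · simpa using fun _ => hl
          · intro x _ _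
            simp
            omega
        · rw [tno hl]
          refine ⟨iarr, iok, fun x hx hx' => ?_⟩
          rcases eq_or_ne x j with rfl | hne
          · exact absurd hx' hl
          · refine iall x ?_ hx'
            push_cast at hx
            omega
    · intro s' hf ⟨i15, _⟩
      rw [i15, hf.1 23 (by decide)]
      simp [h13, hs.r2]
  · rintro s' hf ⟨i15, iarr, iok, iall⟩
    have f13 : s'.reg 13 = y := by rw [hf.1 13 (by decide)]; simp [h13]
    have f2 : s'.reg 2 = 1 := by rw [hf.1 2 (by decide)]; simp [hs.r2]
    refine .add ⟨by simp [f13, f2], iarr, iok, fun x hx => iall x ?_ hx⟩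
    have := hx.1
    push_cast
    omega

/-- The rows `0, …, k` of the table are correct. -/
def TableOK (F : ℕ → ℤ → ℤ → ℤ) (τ : ℤ) (m k : ℕ) (T : ℤ → ℤ) : Prop :=
  ∀ j ≤ k, ∀ z : ℕ, z ≤ m → EntryOK F τ j z (T (j * (m + 1) + z))

theorem runsIn_fillRow (hs : Setup n m s) {k : ℕ} {τ : ℤ}
    (h9 : s.reg 9 = τ) (h10 : s.reg 10 = k) (h11 : s.reg 11 = k * (m + 1))
    (htab : TableOK (value O) τ m k (s.arr 1)) :
    RunsIn O .fillRow s (30 * (m + 1) ^ 2) fun s' =>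
      s'.reg 10 = (k + 1 : ℕ) ∧ s'.reg 11 = (k + 1 : ℕ) * (m + 1) ∧
      TableOK (value O) τ m (k + 1) (s'.arr 1) := by
  let base : ℤ := k * (m + 1)
  let I : ℕ → State → Prop := fun y s' =>
    s'.reg 13 = y ∧ (∀ c, c < base + (m + 1) → s'.arr 1 c = s.arr 1 c) ∧
    ∀ z : ℕ, z < y → EntryOK (value O) τ (k + 1) z (s'.arr 1 (base + (m + 1) + z))
  refine RunsIn.mono (T := 1 + (1 + (((m + 1) * (24 * (m + 1) + 1) + 1) + (1 + 1)))) ?_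
    (by nlinarith) fun _ => id
  refine .add_seq <| .const_seq <| .seq (R := I (m + 1)) ?_ ?_
  · refine RunsIn.whileLt (I := I) (m + 1) ?_ ?_ ?_
    · exact ⟨by simp, by simp, by simp⟩
    · intro y hy s' hf ⟨i13, iarr, iok⟩
      have hs' : Setup n m s' :=
        Setup.frame ((hs.setReg (by norm_num)).setReg (by norm_num)) hf (by decide)
      refine ⟨by rw [i13, hs'.r3]; omega, ?_⟩
      refine RunsIn.mono (runsIn_fillCell (O := O) hs' (k := k) (y := y) (by omega) (τ := τ)
        (base := base) ?_ ?_ ?_ ?_ i13 ?_) le_rfl ?_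
      · rw [hf.1 9 (by decide)]; simp [h9]
      · rw [hf.1 10 (by decide)]; simp [h10]
      · rw [hf.1 11 (by decide)]; simp [h11, base]
      · rw [hf.1 12 (by decide)]; simp [h11, hs.r3, base]
      · intro z hz
        rw [iarr _ (by omega)]
        exact htab k le_rfl z hz
      · rintro t ⟨t13, tarr, tok⟩
        refine ⟨by rw [t13]; push_cast; rfl, fun c hc => ?_, fun z hz => ?_⟩
        · rw [tarr c (by omega), iarr c hc]
        · rcases eq_or_ne z y with rfl | hne
          · exact tok
          · rw [tarr _ (by omega)]
            exact iok z (by omega)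
    · intro s' hf ⟨i13, _⟩
      rw [i13, hf.1 3 (by decide)]
      simp [hs.r3]
  · rintro s' hf ⟨i13, iarr, iok⟩
    have hs' : Setup n m s' :=
      Setup.frame ((hs.setReg (by norm_num)).setReg (by norm_num)) hf (by decide)
    have f12 : s'.reg 12 = base + (m + 1) := by
      rw [hf.1 12 (by decide)]; simp [h11, hs.r3, base]
    have f10 : s'.reg 10 = k := by rw [hf.1 10 (by decide)]; simp [h10]
    have hb : ((k + 1 : ℕ) : ℤ) * (m + 1) = base + (m + 1) := by
      simp only [base]; push_cast; ring
    refine .add_seq <| .add ⟨by simp [f10, hs'.r2], ?_, ?_⟩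
    · rw [hb]
      simp [f12, hs'.r4]
    · intro j hj z hz
      simp only [State.arr_setReg]
      rcases Nat.lt_or_ge k j with h | h
      · obtain rfl : j = k + 1 := by omega
        rw [hb]
        exact iok z (by omega)
      · -- the earlier rows end before the new row begins
        have : (j : ℤ) * (m + 1) ≤ base :=
          mul_le_mul_of_nonneg_right (by exact_mod_cast h) (by positivity)
        rw [iarr _ (by omega)]
        exact htab j h z hz

theorem runsIn_initRow (hs : Setup n m s) {τ : ℤ} :
    RunsIn O .initRow s (6 * (m + 1)) fun s' => TableOK (value O) τ m 0 (s'.arr 1) := by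
  let I : ℕ → State → Prop := fun y s' =>
    s'.reg 13 = y ∧ ∀ z : ℕ, z < y → s'.arr 1 z = -1
  refine RunsIn.mono (T := 1 + (((m + 1) * ((1 + 1) + 1) + 1) + 1)) ?_ (by nlinarith) fun _ => id
  refine .const_seq <| .seq (R := I (m + 1)) ?_ ?_
  · refine RunsIn.whileLt (I := I) (m + 1) ?_ ?_ ?_
    · exact ⟨by simp, by simp⟩
    · intro y hy s' hf ⟨i13, iarr⟩
      have hs' : Setup n m s' := Setup.frame (hs.setReg (by norm_num)) hf (by decide)
      refine ⟨by rw [i13, hs'.r3]; omega, .store_seq <| .add ⟨?_, ?_⟩⟩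
      · simp [i13, hs'.r2]
      · intro z hz
        rcases eq_or_ne z y with rfl | hne
        · simp [i13, hs'.r5]
        · have : (z : ℤ) ≠ y := by exact_mod_cast hne
          simp [i13, Function.update_of_ne this, iarr z (by omega)]
    · intro s' hf ⟨i13, _⟩
      rw [i13, hf.1 3 (by decide)]
      simp [hs.r3]
  · rintro s' hf ⟨-, iarr⟩
    have hs' : Setup n m s' := Setup.frame (hs.setReg (by norm_num)) hf (by decide)
    refine .store fun j hj z hz => ?_
    obtain rfl : j = 0 := by omega
    rcases Nat.eq_zero_or_pos z with rfl | h
    · simp [EntryOK, hs'.r4]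
    · have h' : (z : ℤ) ≠ 0 := by omega
      simp [EntryOK, hs'.r4, Function.update_of_ne h', iarr z (by omega)]
      omega

theorem runsIn_fillTable (hs : Setup n m s) (hn : 0 < n) {τ : ℤ} (h9 : s.reg 9 = τ) :
    RunsIn O .fillTable s (40 * (n * (m + 1) ^ 2)) fun s' =>
      s'.reg 10 = n ∧ s'.reg 11 = n * (m + 1) ∧ TableOK (value O) τ m n (s'.arr 1) := by
  let I : ℕ → State → Prop := fun k s' =>
    s'.reg 10 = k ∧ s'.reg 11 = k * (m + 1) ∧ TableOK (value O) τ m k (s'.arr 1)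
  have hT : 6 * (m + 1) + (1 + (1 + (n * (30 * (m + 1) ^ 2 + 1) + 1))) ≤
      40 * (n * (m + 1) ^ 2) := by
    have h1 : m + 1 ≤ n * (m + 1) ^ 2 := by nlinarith [Nat.zero_le (m * n)]
    have h2 : n ≤ n * (m + 1) ^ 2 := Nat.le_mul_of_pos_right _ (by positivity)
    nlinarith
  refine RunsIn.mono ?_ hT fun _ => id
  refine .seq (runsIn_initRow hs (τ := τ)) fun s₁ hf₁ h₁ => ?_
  have hs₁ : Setup n m s₁ := hs.frame hf₁ (by decide)
  refine .const_seq <| .const_seq <| RunsIn.whileLt (I := I) n ?_ ?_ ?_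
  · exact ⟨by simp, by simp, h₁⟩
  · intro k hk s' hf ⟨i10, i11, iok⟩
    have hs' : Setup n m s' :=
      Setup.frame ((hs₁.setReg (by norm_num)).setReg (by norm_num)) hf (by decide)
    refine ⟨by rw [i10, hs'.r0]; omega, runsIn_fillRow hs' ?_ i10 i11 iok⟩
    rw [hf.1 9 (by decide)]
    simp [hf₁.1 9 (by decide), h9]
  · intro s' hf ⟨i10, _⟩
    rw [i10, hf.1 0 (by decide)]
    simp [hs₁.r0]

end Exec

/-! ### Correctness of the algorithm -/

/-- The array `a` lists the owners of the items in a division with a common threshold. -/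
def IsSolution (F : ℕ → ℤ → ℤ → ℤ) (n m : ℕ) (a : ℤ → ℤ) : Prop :=
  ∃ τ c, IsCutSequence F τ n m c ∧ ∀ j < n, ∀ i, c j ≤ i → i < c (j + 1) → a i = j

/-- The part of a solution that concerns the agents `k, …, n - 1` and the items from `y` on. -/
def IsSuffix (F : ℕ → ℤ → ℤ → ℤ) (τ : ℤ) (n m k : ℕ) (y : ℤ) (a : ℤ → ℤ) : Prop :=
  ∃ c : ℕ → ℤ, c k = y ∧ c n = m ∧ ∀ j, k ≤ j → j < n → y ≤ c j ∧ c j ≤ c (j + 1) ∧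
    Good (F j) τ (c j) (c (j + 1)) ∧ ∀ i, c j ≤ i → i < c (j + 1) → a i = j

theorem IsSuffix.isSolution {F : ℕ → ℤ → ℤ → ℤ} {τ : ℤ} {n m : ℕ} {a : ℤ → ℤ}
    (h : IsSuffix F τ n m 0 0 a) : IsSolution F n m a := by
  obtain ⟨c, h0, hm, hc⟩ := h
  exact ⟨τ, c, ⟨h0, hm, fun j hj => (hc j (Nat.zero_le j) hj).2.1,
    fun j hj => (hc j (Nat.zero_le j) hj).2.2.1⟩, fun j hj => (hc j (Nat.zero_le j) hj).2.2.2⟩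

theorem IsSuffix.cons {F : ℕ → ℤ → ℤ → ℤ} {τ : ℤ} {n m k : ℕ} {x y : ℤ} {a b : ℤ → ℤ}
    (h : IsSuffix F τ n m (k + 1) y a) (hk : k < n) (hx : IsLeftEnd F τ k y x)
    (hold : ∀ i, y ≤ i → b i = a i) (hnew : ∀ i, x ≤ i → i < y → b i = k) :
    IsSuffix F τ n m k x b := by
  obtain ⟨c, hy, hm, hc⟩ := h
  have hu : ∀ j, k + 1 ≤ j → Function.update c k x j = c j := fun j hj =>
    Function.update_of_ne (by omega) _ _
  refine ⟨Function.update c k x, by simp, by rw [hu n hk, hm], fun j hkj hjn => ?_⟩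
  rw [hu (j + 1) (by omega)]
  rcases eq_or_lt_of_le hkj with rfl | hlt
  · rw [Function.update_self, hy]
    exact ⟨le_rfl, hx.1, hx.2.2, hnew⟩
  · rw [hu j hlt]
    obtain ⟨h1, h2, h3, h4⟩ := hc j hlt hjn
    exact ⟨hx.1.trans h1, h2, h3, fun i hi hi' => by rw [hold i (h1.trans hi), h4 i hi hi']⟩

section Exec

variable {O : ℤ → ℤ → ℤ → ℤ} {n m : ℕ} {s : State}

theorem runsIn_traceAgent (hs : Setup n m s) {k : ℕ} (hk : k < n) {τ : ℤ} {y : ℕ} (hy : y ≤ m)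
    (h10 : s.reg 10 = (k + 1 : ℕ)) (h11 : s.reg 11 = (k + 1 : ℕ) * (m + 1)) (h13 : s.reg 13 = y)
    (htab : TableOK (value O) τ m n (s.arr 1)) (hr : Reach (value O) τ (k + 1) y)
    (hsuf : IsSuffix (value O) τ n m (k + 1) y (s.arr 0)) :
    RunsIn O .traceAgent s (8 * (m + 1)) fun s' =>
      s'.reg 10 = k ∧ s'.reg 11 = k * (m + 1) ∧ ∃ x : ℕ, x ≤ m ∧ s'.reg 13 = x ∧
        Reach (value O) τ k x ∧ IsSuffix (value O) τ n m k x (s'.arr 0) := by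
  have hentry := htab (k + 1) hk y hy
  have hleft := hentry.1 (hentry.iff.2 hr)
  obtain ⟨x, hx⟩ := Int.eq_ofNat_of_zero_le hleft.2.1.nonneg
  rw [hx] at hleft
  have hxy : x ≤ y := by exact_mod_cast hleft.1
  have hsub : (((k + 1 : ℕ) : ℤ)) * (m + 1) - (m + 1) = k * (m + 1) := by push_cast; ring
  let I : ℕ → State → Prop := fun j s' =>
    s'.reg 13 = y - j ∧ (∀ i, (y : ℤ) ≤ i → s'.arr 0 i = s.arr 0 i) ∧
    ∀ i : ℤ, y - j ≤ i → i < y → s'.arr 0 i = k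
  refine RunsIn.mono (T := 1 + (1 + (1 + (1 + ((y - x) * (1 + 1 + 1) + 1))))) ?_
    (by omega) fun _ => id
  refine .sub_seq <| .add_seq <| .load_seq <| .sub_seq ?_
  set s₁ := State.setReg _ 11 _ with hs₁
  have hset : Setup n m s₁ := by
    rw [hs₁]
    exact (((hs.setReg (by norm_num)).setReg (by norm_num)).setReg (by norm_num)).setReg
      (by norm_num)
  have e10 : s₁.reg 10 = k := by simp [hs₁, h10, hs.r2]
  have e11 : s₁.reg 11 = k * (m + 1) := by rw [← hsub]; simp [hs₁, h11, hs.r3]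
  have e13 : s₁.reg 13 = y := by simp [hs₁, h13]
  have e15 : s₁.reg 15 = x := by
    rw [← hx]
    simp [hs₁, h11, h13]
  have earr : s₁.arr = s.arr := by simp [hs₁]
  clear_value s₁
  obtain ⟨t, s', hex, ht, h1, h2, h3⟩ := RunsIn.whileLt (O := O) (x := 15) (y := 13)
    (p := .seq (.sub 13 13 2) (.store 0 13 10)) (T := 1 + 1) (I := I) (s := s₁) (y - x)
    ⟨by simp [e13], by simp [earr], by omega⟩
    (by
      intro j hj s' hf ⟨i13, iold, inew⟩
      have f15 : s'.reg 15 = x := by rw [hf.1 15 (by decide), e15]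
      have f10 : s'.reg 10 = k := by rw [hf.1 10 (by decide), e10]
      have f2 : s'.reg 2 = 1 := by rw [hf.1 2 (by decide), hset.r2]
      refine ⟨by rw [i13, f15]; omega, .sub_seq <| .store ⟨?_, ?_, ?_⟩⟩
      · simp [i13, f2]
        ring
      · intro i hi
        have : i ≠ y - j - 1 := by omega
        simp [i13, f2, Function.update_of_ne this, iold i hi]
      · intro i hi hi'
        push_cast at hi
        by_cases h : i = y - j - 1
        · subst h
          simp [i13, f2, f10]
        · simp [i13, f2, Function.update_of_ne h]
          exact inew i (by omega) hi')
    (by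
      intro s' hf ⟨i13, _⟩
      rw [i13, hf.1 15 (by decide), e15]
      omega)
  have hcast : (y : ℤ) - ((y - x : ℕ) : ℤ) = x := by omega
  rw [hcast] at h1 h3
  refine ⟨t, s', hex, ht, ?_, ?_, x, by omega, h1, hleft.2.1, hsuf.cons hk hleft h2 h3⟩
  · rw [hex.frame.1 10 (by decide), e10]
  · rw [hex.frame.1 11 (by decide), e11]

theorem runsIn_trace (hs : Setup n m s) (hn : 0 < n) {τ : ℤ} (h10 : s.reg 10 = n)
    (h11 : s.reg 11 = n * (m + 1)) (htab : TableOK (value O) τ m n (s.arr 1)) :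
    RunsIn O .trace s (14 * (n * (m + 1))) fun s' =>
      (IsSolution (value O) n m (s.arr 0) → IsSolution (value O) n m (s'.arr 0)) ∧
      (Reach (value O) τ n m → IsSolution (value O) n m (s'.arr 0)) := by
  have hreach := (htab n le_rfl m le_rfl).iff
  let I : ℕ → State → Prop := fun j s' =>
    s'.reg 10 = (n - j : ℕ) ∧ s'.reg 11 = (n - j : ℕ) * (m + 1) ∧ ∃ y : ℕ, y ≤ m ∧ s'.reg 13 = y ∧
      Reach (value O) τ (n - j) y ∧ IsSuffix (value O) τ n m (n - j) y (s'.arr 0)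
  have hT : 1 + (1 + (1 + (n * (8 * (m + 1) + 1) + 1) + 1)) ≤ 14 * (n * (m + 1)) := by
    nlinarith [Nat.zero_le (m * n)]
  refine RunsIn.mono ?_ hT fun _ => id
  refine .add_seq <| .load_seq <| .ifLt (fun hlt => ?_) fun hlt => ?_
  · have hr : Reach (value O) τ n m := by
      rw [← hreach]
      simpa [h11, hs.r1, hs.r5] using hlt
    refine RunsIn.mono (Q := I n) (.add_seq <| RunsIn.whileLt (I := I) n ?_ ?_ ?_) le_rfl ?_
    · refine ⟨by simp [h10], by simp [h11], m, le_rfl, by simp [hs.r1, hs.r4], hr, ?_⟩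
      exact ⟨fun _ => m, rfl, rfl, fun j h1 h2 => by omega⟩
    · intro j hj s' hf ⟨i10, i11, y, hy, i13, ir, isuf⟩
      obtain ⟨k, hk⟩ : ∃ k, n - j = k + 1 := ⟨n - j - 1, by omega⟩
      have hk' : n - (j + 1) = k := by omega
      have hset : Setup n m s' := Setup.frame (((hs.setReg (by norm_num)).setReg
        (by norm_num)).setReg (by norm_num)) hf (by decide)
      rw [hk] at i10 i11 ir isuf
      refine ⟨by rw [i10, hset.r4]; positivity, ?_⟩
      simp only [I, hk']
      refine runsIn_traceAgent hset (by omega) hy i10 i11 i13 ?_ ir isuf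
      rw [hf.2 1 (by decide)]
      exact htab
    · intro s' hf ⟨i10, _⟩
      rw [i10, hf.1 4 (by decide)]
      simp [hs.r4]
    · rintro s' ⟨-, -, y, -, -, ir, isuf⟩
      rw [Nat.sub_self] at ir isuf
      have hy : (y : ℤ) = 0 := ir
      rw [hy] at isuf
      exact ⟨fun _ => isuf.isSolution, fun _ => isuf.isSolution⟩
  · have hr : ¬Reach (value O) τ n m := by
      rw [← hreach]
      simpa [h11, hs.r1, hs.r5] using hlt
    refine RunsIn.mono (.skip (Q := fun s' => s'.arr 0 = s.arr 0) (by simp)) (by omega) ?_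
    exact fun s' h => ⟨fun h' => h ▸ h', fun h' => absurd h' hr⟩

theorem runsIn_tryThreshold (hs : Setup n m s) (hn : 0 < n) {i l r : ℕ} (h6 : s.reg 6 = i)
    (h7 : s.reg 7 = l) (h8 : s.reg 8 = r) :
    RunsIn O .tryThreshold s (60 * (n * (m + 1) ^ 2)) fun s' =>
      s'.reg 8 = r + 1 ∧
      (IsSolution (value O) n m (s.arr 0) → IsSolution (value O) n m (s'.arr 0)) ∧
      (Reach (value O) (value O i l r) n m → IsSolution (value O) n m (s'.arr 0)) := by
  have hT : 1 + (1 + (40 * (n * (m + 1) ^ 2) + (14 * (n * (m + 1)) + 1))) ≤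
      60 * (n * (m + 1) ^ 2) := by
    have h1 : n * (m + 1) ≤ n * (m + 1) ^ 2 :=
      Nat.mul_le_mul_left _ (Nat.le_self_pow (by norm_num) _)
    have h2 : 1 ≤ n * (m + 1) ^ 2 := Nat.mul_pos hn (by positivity)
    omega
  refine RunsIn.mono ?_ hT fun _ => id
  refine .sub_seq <| .query_seq ?_
  set s₁ := State.setReg _ 9 _ with hs₁
  have hset : Setup n m s₁ := by
    rw [hs₁]
    exact (hs.setReg (by norm_num)).setReg (by norm_num)
  have e8 : s₁.reg 8 = r := by simp [hs₁, h8]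
  have e9 : s₁.reg 9 = value O i l r := by simp [hs₁, h6, h7, h8, hs.r2, value]
  have earr : s₁.arr = s.arr := by simp [hs₁]
  clear_value s₁
  refine .seq (runsIn_fillTable hset hn e9) fun s₂ hf₂ ⟨h10, h11, htab⟩ => ?_
  have hset₂ : Setup n m s₂ := hset.frame hf₂ (by decide)
  refine .seq (runsIn_trace hset₂ hn h10 h11 htab) fun s₃ hf₃ ⟨hold, hnew⟩ => ?_
  have hset₃ : Setup n m s₃ := hset₂.frame hf₃ (by decide)
  refine .add ⟨?_, fun h => hold ?_, hnew⟩
  · simp [hf₃.1 8 (by decide), hf₂.1 8 (by decide), e8, hset₃.r2]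
  · rwa [hf₂.2 0 (by decide), earr]

theorem runsIn_solve (hn : 0 < n) :
    RunsIn O .solve (initState n m) (80 * (n ^ 2 * (m + 1) ^ 4)) fun s' =>
      ∀ i < n, ∀ l ≤ m, ∀ r ≤ m, Reach (value O) (value O i l r) n m →
        IsSolution (value O) n m (s'.arr 0) := by
  let S : State → Prop := fun s' => IsSolution (value O) n m (s'.arr 0)
  let I₁ : ℕ → State → Prop := fun i s' => s'.reg 6 = i ∧
    ∀ i' < i, ∀ l ≤ m, ∀ r ≤ m, Reach (value O) (value O i' l r) n m → S s'
  let A : ℕ := 60 * (n * (m + 1) ^ 2)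
  let B : ℕ := (m + 1) * (A + 1) + 1
  let D : ℕ := (m + 1) * (1 + (B + 1) + 1) + 1
  have hT : 1 + (1 + (1 + (1 + (1 + (n * (1 + (D + 1) + 1) + 1))))) ≤
      80 * (n ^ 2 * (m + 1) ^ 4) := by
    simp only [D, B, A]
    have e1 : 1 ≤ n ^ 2 * (m + 1) ^ 4 := Nat.mul_pos (by positivity) (by positivity)
    have e2 : n * (m + 1) ^ 2 ≤ n ^ 2 * (m + 1) ^ 4 :=
      Nat.mul_le_mul (Nat.le_self_pow (by norm_num) _)
        (Nat.pow_le_pow_right (by omega) (by norm_num))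
    have e3 : n * (m + 1) ≤ n * (m + 1) ^ 2 :=
      Nat.mul_le_mul_left _ (Nat.le_self_pow (by norm_num) _)
    have e4 : n ≤ n * (m + 1) := Nat.le_mul_of_pos_right _ (by omega)
    have e5 : n * (1 + ((m + 1) * (1 + ((m + 1) * (60 * (n * (m + 1) ^ 2) + 1) + 1 + 1) + 1) + 1
        + 1) + 1) = 60 * (n ^ 2 * (m + 1) ^ 4) + n * (m + 1) ^ 2 + 4 * (n * (m + 1)) + 4 * n := by
      ring
    omega
  refine RunsIn.mono (Q := I₁ n) ?_ hT fun s' h => h.2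
  refine .const_seq <| .const_seq <| .const_seq <| .add_seq <| .const_seq ?_
  set s := State.setReg _ 6 _ with hs
  have hset : Setup n m s := by
    constructor <;> simp [hs, initState]
  have e6 : s.reg 6 = 0 := by simp [hs]
  clear_value s
  refine RunsIn.whileLt (I := I₁) n ⟨by simp [e6], by simp⟩ ?_ ?_
  · intro i hi s₁ hf₁ ⟨i6, iS⟩
    have hset₁ : Setup n m s₁ := hset.frame hf₁ (by decide)
    refine ⟨by rw [i6, hset₁.r0]; omega, ?_⟩
    let I₂ : ℕ → State → Prop := fun l s' => s'.reg 7 = l ∧ (S s₁ → S s') ∧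
      ∀ l' < l, ∀ r ≤ m, Reach (value O) (value O i l' r) n m → S s'
    refine .const_seq <| .seq (R := I₂ (m + 1)) ?_ ?_
    · refine RunsIn.whileLt (I := I₂) (m + 1) ⟨by simp, by simp [S], by simp⟩ ?_ ?_
      · intro l hl s₂ hf₂ ⟨i7, iold, iS'⟩
        have hset₂ : Setup n m s₂ := Setup.frame (hset₁.setReg (by norm_num)) hf₂ (by decide)
        have f6 : s₂.reg 6 = i := by rw [hf₂.1 6 (by decide)]; simp [i6]
        refine ⟨by rw [i7, hset₂.r3]; omega, ?_⟩
        let I₃ : ℕ → State → Prop := fun r s' => s'.reg 8 = r ∧ (S s₂ → S s') ∧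
          ∀ r' < r, Reach (value O) (value O i l r') n m → S s'
        refine .const_seq <| .seq (R := I₃ (m + 1)) ?_ ?_
        · refine RunsIn.whileLt (I := I₃) (m + 1) ⟨by simp, by simp [S], by simp⟩ ?_ ?_
          · intro r hr s₃ hf₃ ⟨i8, iold', iS''⟩
            have hset₃ : Setup n m s₃ := Setup.frame (hset₂.setReg (by norm_num)) hf₃ (by decide)
            refine ⟨by rw [i8, hset₃.r3]; omega, ?_⟩
            refine RunsIn.mono (runsIn_tryThreshold (O := O) hset₃ hn (i := i) (l := l) (r := r)
              ?_ ?_ i8) le_rfl ?_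
            · rw [hf₃.1 6 (by decide)]; simp [f6]
            · rw [hf₃.1 7 (by decide)]; simp [i7]
            · rintro s' ⟨h8, hold, hnew⟩
              refine ⟨by rw [h8]; push_cast; rfl, fun h => hold (iold' h), fun r' hr' hR => ?_⟩
              rcases eq_or_ne r' r with rfl | hne
              · exact hnew hR
              · exact hold (iS'' r' (by omega) hR)
          · intro s' hf ⟨i8, _⟩
            rw [i8, hf.1 3 (by decide)]
            simp [hset₂.r3]
        · rintro s' hf ⟨-, hold, hnew⟩
          have f7 : s'.reg 7 = l := by rw [hf.1 7 (by decide)]; simp [i7]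
          have f2 : s'.reg 2 = 1 := by rw [hf.1 2 (by decide)]; simp [hset₂.r2]
          refine .add ⟨by simp [f7, f2], fun h => hold (iold h), fun l' hl' r hr hR => ?_⟩
          rcases eq_or_ne l' l with rfl | hne
          · exact hnew r (by omega) hR
          · exact hold (iS' l' (by omega) r hr hR)
      · intro s' hf ⟨i7, _⟩
        rw [i7, hf.1 3 (by decide)]
        simp [hset₁.r3]
    · rintro s' hf ⟨-, hold, hnew⟩
      have f6 : s'.reg 6 = i := by rw [hf.1 6 (by decide)]; simp [i6]
      have f2 : s'.reg 2 = 1 := by rw [hf.1 2 (by decide)]; simp [hset₁.r2]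
      refine .add ⟨by simp [f6, f2], fun i' hi' l hl r hr hR => ?_⟩
      rcases eq_or_ne i' i with rfl | hne
      · exact hnew l (by omega) r hr hR
      · exact hold (iS i' (by omega) l hl r hr hR)
  · intro s' hf ⟨i6, _⟩
    rw [i6, hf.1 0 (by decide), hset.r0]
    exact lt_irrefl _

end Exec

theorem IsCutSequence.outputs {F : ℕ → ℤ → ℤ → ℤ} {n m : ℕ} {s : State} {τ : ℤ} {c : ℕ → ℤ}
    (hc : IsCutSequence F τ n m c)
    (h : ∀ j < n, ∀ i, c j ≤ i → i < c (j + 1) → s.arr 0 i = j) :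
    s.Outputs (cutAllocation n m c) := by
  intro i k
  rw [mem_cutAllocation]
  refine ⟨fun hk => h i i.2 _ hk.1 hk.2, fun hk => ?_⟩
  obtain ⟨j, hj, h1, h2⟩ := hc.exists_index (k := (k : ℤ)) (by omega) (by omega)
  have h3 := h j hj _ h1 h2
  obtain rfl : j = i := by omega
  exact ⟨h1, h2⟩

/-- The algorithm writes down an allocation with the required properties in time
`O (n² (m + 1)⁴)`. -/
theorem exists_exec_solve {n m : ℕ} (hn : 0 < n) {v : Fin n → Finset (Fin m) → ℤ}
    (hv : IsValuation v) (hneg : IsNonpositive v) :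
    ∃ (t : ℕ) (s : State) (A : Fin n → Finset (Fin m)),
      Exec (oracle v) Prog.solve (initState n m) t s ∧ t ≤ 1280 * (n ^ 2 * (max m 1) ^ 4) ∧
      s.Outputs A ∧ IsAllocation A ∧ IsEQ1Pgc v A ∧ IsEQ1gc v A := by
  obtain ⟨t, s, hex, ht, hsol⟩ := runsIn_solve (O := oracle v) (m := m) hn
  obtain ⟨i, hi, x, y, hx0, hxm, hy0, hym, hR⟩ := exists_value_reach hn hv hneg
  lift x to ℕ using hx0
  lift y to ℕ using hy0
  obtain ⟨τ, c, hc, harr⟩ := hsol i hi x (by omega) y (by omega) hR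
  refine ⟨t, s, cutAllocation n m c, hex, ht.trans ?_, hc.outputs harr,
    hc.isAllocation, hc.isEQ1Pgc, hc.isEQ1Pgc.isEQ1gc⟩
  have h1 : (m + 1) ^ 4 ≤ (2 * max m 1) ^ 4 := Nat.pow_le_pow_left (by omega) 4
  rw [mul_pow] at h1
  calc 80 * (n ^ 2 * (m + 1) ^ 4) ≤ 80 * (n ^ 2 * (2 ^ 4 * max m 1 ^ 4)) := by gcongr
    _ = 1280 * (n ^ 2 * (max m 1) ^ 4) := by ring

end PathFairDivision

theorem mainTheorem2 :
    (∀ (n m : ℕ), 0 < n → ∀ v : Fin n → Finset (Fin m) → ℤ,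
      PathFairDivision.IsValuation v → PathFairDivision.IsNonpositive v →
        ∃ A : Fin n → Finset (Fin m), PathFairDivision.IsAllocation A ∧
          PathFairDivision.IsEQ1Pgc v A ∧ PathFairDivision.IsEQ1gc v A) ∧
    (∃ (P : PathFairDivision.Prog) (C : ℕ),
      ∀ (n m : ℕ), 0 < n → ∀ v : Fin n → Finset (Fin m) → ℤ,
        PathFairDivision.IsValuation v → PathFairDivision.IsNonpositive v →
          ∃ (t : ℕ) (s : PathFairDivision.State) (A : Fin n → Finset (Fin m)),
            PathFairDivision.Exec (PathFairDivision.oracle v) P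
              (PathFairDivision.initState n m) t s ∧
            t ≤ C * (n ^ 2 * (max m 1) ^ 4) ∧
            s.Outputs A ∧ PathFairDivision.IsAllocation A ∧
            PathFairDivision.IsEQ1Pgc v A ∧ PathFairDivision.IsEQ1gc v A) := by
  refine ⟨fun n m hn v hv hneg => ?_, .solve, 1280, fun n m hn v hv hneg =>
    PathFairDivision.exists_exec_solve hn hv hneg⟩
  obtain ⟨-, -, A, -, -, -, h⟩ := PathFairDivision.exists_exec_solve hn hv hneg
  exact ⟨A, h⟩
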